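/- Let $\mathbb{H}^2=\{(z_1,z_2)\in\mathbb{C}^2:\Im z_1>0,\ \Im z_2>0\}$ and let $H^2(\mathbb{H}^2)$ be the Hardy space of holomorphic $F$ on $\mathbb{H}^2$ with $\sup_{y_1,y_2>0}\int_{\mathbb{R}^2}|F(x+iy)|^2\,dx<\infty$, regarded as a closed subspace of $L^2(\mathbb{R}^2)$ via boundary functions; let $P$ be the orthogonal projection of $L^2(\mathbb{R}^2)$ onto it. For $\sigma\in L^\infty(\mathbb{R}^2)$ let $T_\sigma f=P(\sigma f)$ be the Toeplitz operator on $H^2(\mathbb{H}^2)$. For a bounded measurable function $\vartheta$ on $(\mathbb{R}^+)^2$ let $D_\vartheta=\mathcal{F}^{-1}M_\vartheta\mathcal{F}$ be the Fourier multiplier on $H^2(\mathbb{H}^2)$, where $(\mathcal{F}f)(t)=\frac1{2\pi}\int_{\mathbb{R}^2}f(x)e^{-ix\cdot t}\,dx$ maps $H^2(\mathbb{H}^2)$ onto $L^2((\mathbb{R}^+)^2)$ and $M_\vartheta$ is multiplication by $\vartheta$. For $p_1,p_2>0$ let $(V_{p_1,p_2}f)(z_1,z_2)=f(p_1z_1,p_2z_2)$.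 Let $\varphi(z_1,z_2)=(p_1z_1+\psi_1(z_1,z_2),\,p_2z_2+\psi_2(z_1,z_2))$, where $p_1,p_2>0$, $\psi_1,\psi_2$ are bounded holomorphic functions on $\mathbb{H}^2$, and there is $\epsilon>0$ with $\Im\psi_j(z)>\epsilon$ for all $z\in\mathbb{H}^2$, $j=1,2$. Then $C_\varphi f=f\circ\varphi$ is a bounded operator on $H^2(\mathbb{H}^2)$, the functions $\psi_1,\psi_2$ have bounded boundary functions on $\mathbb{R}^2$ (denoted by the same letters), and there is $\alpha>0$ such that $$C_\varphi=V_{p_1,p_2}\sum_{n,m=0}^{\infty}T_{\tau_1^n}T_{\tau_2^m}D_{\vartheta_{1,n}}D_{\vartheta_{2,m}},$$ where the double series converges (unconditionally, as a sum over $(n,m)\in\mathbb{N}^2$) in operator norm, $$\tau_j(x_1,x_2)=i\alpha-\tilde\psi_j(x_1,x_2),\qquad \tilde\psi_j(x_1,x_2)=\psi_j\Big(\frac{x_1}{p_1},\frac{x_2}{p_2}\Big),$$ and $$\vartheta_{1,n}(t_1,t_2)=\frac{(-it_1)^ne^{-\alpha t_1}}{n!},\qquad \vartheta_{2,m}(t_1,t_2)=\frac{(-it_2)^me^{-\alpha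 t_2}}{m!};$$ the operators $D_{\vartheta_{1,n}}$, $D_{\vartheta_{2,m}}$ and $V_{p_1,p_2}$ are bounded operators of $H^2(\mathbb{H}^2)$ into itself. -/

import Mathlib

open MeasureTheory Filter Topology

open scoped ENNReal NNReal

noncomputable section

namespace BiHardy

/-- The Euclidean plane `ℝ²`, the distinguished boundary of the product of two half-planes. -/
abbrev Plane : Type := EuclideanSpace ℝ (Fin 2)

/-- `L²(ℝ²)` with respect to Lebesgue measure. -/
abbrev L2 : Type := Lp (α := Plane) ℂ 2 volume

/-- The two dimensional upper half-plane `ℍ² = {(z₁, z₂) : Im z₁ > 0, Im z₂ > 0}`. -/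
def upperHalf : Set (Fin 2 → ℂ) := {z | ∀ j, 0 < (z j).im}

/-- The point `x + i y` of `ℂ²`, for `x, y ∈ ℝ²`. -/
def point (x : Plane) (y : Fin 2 → ℝ) : Fin 2 → ℂ :=
  fun j => ((x j : ℝ) : ℂ) + ((y j : ℝ) : ℂ) * Complex.I

/-- The slice `x ↦ F (x + i y)`. -/
def slice (F : (Fin 2 → ℂ) → ℂ) (y : Fin 2 → ℝ) : Plane → ℂ :=
  fun x => F (point x y)

/-- `b` is the boundary function on `ℝ²` of the function `F` on `ℍ²`: the slices `F (· + i y)`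
converge to `b` in `L²` of every ball when `y → 0` with `y₁, y₂ > 0`.
For functions in `H²(ℍ²)` or `H^∞(ℍ²)` this agrees almost everywhere with the pointwise limit
`lim_{y → 0+} F (x₁ + i y, x₂ + i y)`. -/
def IsBoundaryFunction (F : (Fin 2 → ℂ) → ℂ) (b : Plane → ℂ) : Prop :=
  AEStronglyMeasurable b volume ∧
    ∀ R : ℝ, Tendsto
      (fun y : Fin 2 → ℝ =>
        eLpNorm (fun x => slice F y x - b x) 2 (volume.restrict (Metric.closedBall (0 : Plane) R)))
      (𝓝[{y | ∀ j, 0 < y j}] 0) (𝓝 0)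

/-- `F` is in the Hardy class `H²(ℍ²)`: holomorphic on `ℍ²`, with
`sup_{y₁, y₂ > 0} ∫ |F (x + i y)|² dx < ∞`. -/
def HardyClass (F : (Fin 2 → ℂ) → ℂ) : Prop :=
  DifferentiableOn ℂ F upperHalf ∧
    ∃ M : ℝ≥0, ∀ y : Fin 2 → ℝ, (∀ j, 0 < y j) → eLpNorm (slice F y) 2 volume ≤ M

/-- `F` is a function in the Hardy class whose boundary function is `f`. -/
def IsHardyExtension (F : (Fin 2 → ℂ) → ℂ) (f : L2) : Prop :=
  HardyClass F ∧ IsBoundaryFunction F f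

theorem continuous_point (y : Fin 2 → ℝ) : Continuous fun x : Plane => point x y := by
  unfold point
  fun_prop

theorem point_mem (x : Plane) {y : Fin 2 → ℝ} (hy : ∀ j, 0 < y j) : point x y ∈ upperHalf := by
  intro j
  simpa [point] using hy j

theorem HardyClass.aestronglyMeasurable_slice {F : (Fin 2 → ℂ) → ℂ}
    (hF : DifferentiableOn ℂ F upperHalf) {y : Fin 2 → ℝ} (hy : ∀ j, 0 < y j) (μ : Measure Plane) :
    AEStronglyMeasurable (slice F y) μ := by
  have h : Continuous (slice F y) := by
    have := hF.continuousOn.comp_continuous (continuous_point y) (fun x => point_mem x hy)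
    exact this
  exact h.aestronglyMeasurable

theorem IsHardyExtension.zero : IsHardyExtension (fun _ => 0) 0 := by
  refine ⟨⟨differentiableOn_const _, 0, fun y _ => ?_⟩, ?_, fun R => ?_⟩
  · have : slice (fun _ => (0 : ℂ)) y = 0 := rfl
    simp [this]
  · exact Lp.aestronglyMeasurable _
  · have h : ∀ y : Fin 2 → ℝ,
        eLpNorm (fun x => slice (fun _ => (0 : ℂ)) y x - (0 : L2) x) 2
          (volume.restrict (Metric.closedBall (0 : Plane) R)) = 0 := by
      intro y
      rw [← eLpNorm_zero (α := Plane) (ε := ℂ) (p := 2)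
        (μ := volume.restrict (Metric.closedBall (0 : Plane) R))]
      refine eLpNorm_congr_ae (ae_restrict_of_ae ?_)
      filter_upwards with x
      simp [slice]
    simp only [h]
    exact tendsto_const_nhds

theorem IsHardyExtension.add {F G : (Fin 2 → ℂ) → ℂ} {f g : L2}
    (hF : IsHardyExtension F f) (hG : IsHardyExtension G g) :
    IsHardyExtension (fun z => F z + G z) (f + g) := by
  obtain ⟨⟨dF, M, hM⟩, -, bF⟩ := hF
  obtain ⟨⟨dG, N, hN⟩, -, bG⟩ := hG
  refine ⟨⟨dF.add dG, M + N, fun y hy => ?_⟩, Lp.aestronglyMeasurable _, fun R => ?_⟩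
  · have h1 := HardyClass.aestronglyMeasurable_slice dF hy volume
    have h2 := HardyClass.aestronglyMeasurable_slice dG hy volume
    calc eLpNorm (slice (fun z => F z + G z) y) 2 volume
        = eLpNorm (slice F y + slice G y) 2 volume := rfl
      _ ≤ eLpNorm (slice F y) 2 volume + eLpNorm (slice G y) 2 volume :=
          eLpNorm_add_le h1 h2 (by norm_num)
      _ ≤ ((M + N : ℝ≥0) : ℝ≥0∞) := by
          rw [ENNReal.coe_add]
          exact add_le_add (hM y hy) (hN y hy)
  · have hlim := (bF R).add (bG R)
    rw [add_zero] at hlim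
    refine tendsto_of_tendsto_of_tendsto_of_le_of_le' tendsto_const_nhds hlim
      (Eventually.of_forall fun _ => zero_le) ?_
    filter_upwards [self_mem_nhdsWithin] with y hy
    have h1 := (HardyClass.aestronglyMeasurable_slice dF hy
      (volume.restrict (Metric.closedBall (0 : Plane) R))).sub
      (Lp.aestronglyMeasurable f).restrict
    have h2 := (HardyClass.aestronglyMeasurable_slice dG hy
      (volume.restrict (Metric.closedBall (0 : Plane) R))).sub
      (Lp.aestronglyMeasurable g).restrict
    refine le_trans (le_of_eq ?_) (eLpNorm_add_le h1 h2 (by norm_num))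
    refine eLpNorm_congr_ae (ae_restrict_of_ae ?_)
    filter_upwards [Lp.coeFn_add f g] with x hx
    simp only [hx, slice, Pi.add_apply]
    ring

theorem IsHardyExtension.smul (c : ℂ) {F : (Fin 2 → ℂ) → ℂ} {f : L2}
    (hF : IsHardyExtension F f) : IsHardyExtension (fun z => c * F z) (c • f) := by
  obtain ⟨⟨dF, M, hM⟩, -, bF⟩ := hF
  refine ⟨⟨dF.const_mul c, ‖c‖₊ * M, fun y hy => ?_⟩, Lp.aestronglyMeasurable _, fun R => ?_⟩
  · calc eLpNorm (slice (fun z => c * F z) y) 2 volume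
        = eLpNorm (c • slice F y) 2 volume := rfl
      _ = ‖c‖ₑ * eLpNorm (slice F y) 2 volume := eLpNorm_const_smul _ _ _ _
      _ ≤ ((‖c‖₊ * M : ℝ≥0) : ℝ≥0∞) := by
          rw [ENNReal.coe_mul]
          exact mul_le_mul_right (hM y hy) _
  · have hlim := ENNReal.Tendsto.const_mul (a := ‖c‖ₑ) (bF R) (Or.inr enorm_ne_top)
    rw [mul_zero] at hlim
    refine hlim.congr fun y => ?_
    rw [← eLpNorm_const_smul]
    refine eLpNorm_congr_ae (ae_restrict_of_ae ?_)
    filter_upwards [Lp.coeFn_smul c f] with x hx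
    simp only [hx, slice, Pi.smul_apply, smul_eq_mul]
    ring

/-- The boundary functions of the Hardy class, as a linear subspace of `L²(ℝ²)`. -/
def hardyBoundary : Submodule ℂ L2 where
  carrier := {f | ∃ F, IsHardyExtension F f}
  zero_mem' := ⟨_, IsHardyExtension.zero⟩
  add_mem' := by
    rintro f g ⟨F, hF⟩ ⟨G, hG⟩
    exact ⟨_, hF.add hG⟩
  smul_mem' := by
    rintro c f ⟨F, hF⟩
    exact ⟨_, hF.smul c⟩

/-- The Hardy space `H²(ℍ²)` as a closed subspace of `L²(ℝ²)` via boundary functions.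
(The space of boundary functions is already closed; the closure makes this visible to the
orthogonal projection.) -/
def H2 : Submodule ℂ L2 := hardyBoundary.topologicalClosure

instance instCompleteSpaceH2 : CompleteSpace H2 :=
  hardyBoundary.isClosed_topologicalClosure.completeSpace_coe

/-- Multiplication by an essentially bounded function on `L²(ℝ²)`
(and `0` if the function is not essentially bounded). -/
def mulL2 (σ : Plane → ℂ) : L2 →L[ℂ] L2 :=
  open Classical in
  if h : MemLp σ ∞ volume then
    (ContinuousLinearMap.mul ℂ ℂ).holderL (volume : Measure Plane) ∞ 2 2 h.toLp
  else 0

/-- The Toeplitz operator `T_σ f = P (σ f)` on `H²(ℍ²)`, where `P` is the orthogonal projection of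
`L²(ℝ²)` onto `H²(ℍ²)`. -/
def toeplitz (σ : Plane → ℂ) : H2 →L[ℂ] H2 :=
  H2.orthogonalProjectionOnto ∘L mulL2 σ ∘L H2.subtypeL

/-- The function `ϑ` on the open quadrant `(ℝ⁺)²`, extended by zero, in the variable `ξ = t / 2π`:
`(ℱ f)(t) = (2π)⁻¹ ∫ f(x) e^{-i x·t} dx` equals `(2π)⁻¹ (𝓕 f)(t / 2π)` for the Fourier transform
`(𝓕 f)(ξ) = ∫ f(x) e^{-2π i x·ξ} dx`, so multiplication of `ℱ f` by `ϑ(t)` is multiplication of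
`𝓕 f` by `ϑ(2π ξ)`. -/
def quadrantSymbol (ϑ : (Fin 2 → ℝ) → ℂ) : Plane → ℂ :=
  {ξ : Plane | ∀ j, 0 < ξ j}.indicator fun ξ => ϑ fun j => 2 * Real.pi * ξ j

/-- `ℱ⁻¹ M_ϑ ℱ` on `L²(ℝ²)`, where `M_ϑ` is multiplication by `ϑ` on the quadrant `(ℝ⁺)²`. -/
def fourierMultiplierL2 (ϑ : (Fin 2 → ℝ) → ℂ) : L2 →L[ℂ] L2 :=
  (Lp.fourierTransformₗᵢ Plane ℂ).symm.toContinuousLinearEquiv.toContinuousLinearMap ∘L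
    mulL2 (quadrantSymbol ϑ) ∘L
      (Lp.fourierTransformₗᵢ Plane ℂ).toContinuousLinearEquiv.toContinuousLinearMap

/-- The Fourier multiplier `D_ϑ = ℱ⁻¹ M_ϑ ℱ` as an operator on `H²(ℍ²)`. Since `ℱ⁻¹ M_ϑ ℱ` maps
`H²(ℍ²)` into itself, the projection only adjusts the codomain. -/
def fourierMultiplier (ϑ : (Fin 2 → ℝ) → ℂ) : H2 →L[ℂ] H2 :=
  H2.orthogonalProjectionOnto ∘L fourierMultiplierL2 ϑ ∘L H2.subtypeL

/-- The multiplier `ϑ_{j,n}(t₁, t₂) = (-i t_j)^n e^{-α t_j} / n!`. -/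
def theta (α : ℝ) (j : Fin 2) (n : ℕ) : (Fin 2 → ℝ) → ℂ :=
  fun t => (-Complex.I * (t j : ℂ)) ^ n * Complex.exp (-((α : ℂ) * (t j : ℂ))) / (n.factorial : ℂ)

/-- `C` is the composition operator `f ↦ f ∘ φ` on `H²(ℍ²)`: every `f` in `H²(ℍ²)` is the boundary
function of a function in the Hardy class, and whenever `F` in the Hardy class has boundary
function `f`, then `F ∘ φ` is in the Hardy class and has boundary function `C f`. -/
def IsCompositionOperator (φ : (Fin 2 → ℂ) → (Fin 2 → ℂ)) (C : H2 →L[ℂ] H2) : Prop :=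
  ∀ f : H2, (∃ F, IsHardyExtension F f) ∧
    ∀ F, IsHardyExtension F f → IsHardyExtension (F ∘ φ) (C f)

/-- The dilation `(z₁, z₂) ↦ (p₁ z₁, p₂ z₂)`. -/
def dilation (p : Fin 2 → ℝ) : (Fin 2 → ℂ) → (Fin 2 → ℂ) :=
  fun z j => (p j : ℂ) * z j

/-- The symbol `τ(x₁, x₂) = i α - b(x₁ / p₁, x₂ / p₂)`. -/
def tau (α : ℝ) (p : Fin 2 → ℝ) (b : Plane → ℂ) : Plane → ℂ :=
  fun x => Complex.I * (α : ℂ) - b (WithLp.toLp 2 fun k => x k / p k)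

/-- The multipliers `ϑ_{j,n}` are essentially bounded. -/
theorem memLp_quadrantSymbol_theta {α : ℝ} (hα : 0 < α) (j : Fin 2) (n : ℕ) :
    MemLp (quadrantSymbol (theta α j n)) ∞ volume := by
  have hset : MeasurableSet {ξ : Plane | ∀ j, 0 < ξ j} := by
    simp only [Set.ofPred_forall]
    exact MeasurableSet.iInter fun k => measurableSet_lt measurable_const (by fun_prop)
  have hcont : Continuous fun ξ : Plane => theta α j n fun k => 2 * Real.pi * ξ k := by
    unfold theta
    fun_prop
  refine memLp_top_of_bound (hcont.aestronglyMeasurable.indicator hset) ((α ^ n)⁻¹)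
    (Eventually.of_forall fun ξ => ?_)
  unfold quadrantSymbol
  by_cases hξ : ξ ∈ {ξ : Plane | ∀ j, 0 < ξ j}
  · rw [Set.indicator_of_mem hξ]
    have ht : 0 < 2 * Real.pi * ξ j := by
      have := hξ j
      positivity
    unfold theta
    set t : ℝ := 2 * Real.pi * ξ j with htdef
    have hexp : ‖Complex.exp (-((α : ℂ) * (t : ℂ)))‖ = Real.exp (-(α * t)) := by
      rw [Complex.norm_exp]
      norm_num
    have h1 := Real.pow_div_factorial_le_exp (α * t) (by positivity) n
    rw [norm_div, norm_mul, norm_pow, norm_mul, norm_neg, Complex.norm_I, one_mul, hexp,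
      Complex.norm_real, Complex.norm_natCast, Real.norm_of_nonneg ht.le, Real.exp_neg]
    rw [mul_pow] at h1
    have hf : (0 : ℝ) < n.factorial := by positivity
    have hp : 0 < α ^ n := by positivity
    have he := Real.exp_pos (α * t)
    rw [div_le_iff₀ hf] at h1
    rw [div_le_iff₀ hf, ← div_eq_mul_inv, div_le_iff₀ he, inv_mul_eq_div, div_mul_eq_mul_div,
      le_div_iff₀ hp]
    nlinarith
  · rw [Set.indicator_of_notMem hξ, norm_zero]
    positivity

end BiHardy

end

open MeasureTheory Filter Topology

open scoped ENNReal NNReal FourierTransform SchwartzMap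

noncomputable section

namespace BiHardy

/-! By Paley–Wiener, `f` lies in `H²(ℍ²)` exactly when its Fourier transform vanishes off the
quadrant, and the holomorphic function with boundary values `f` is then `F(z) = ∫ f̂(ξ) e^{2πi z·ξ}
dξ` (`ext`, `H2_eq_spectral`). With `w = (p₁z₁, p₂z₂)` one has `F(φ(z)) = F(w + ψ̃(w))`, so `C_φ` is
the dilation `V` after an operator `S` that shifts the argument by `ψ̃(w)`. Put `ψ̃_j = iα - τ_j`
and `t = 2πξ`. The shift multiplies the integrand by the product over `j` of `e^{i t_j ψ̃_j} = e^{-α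
t_j} e^{-i t_j τ_j} = ∑ τ_jⁿ (-i t_j)ⁿ e^{-α t_j} / n!`. For fixed `w` the `τ_j(w)` are constants,
so termwise integration gives `∑ τ₁ⁿ τ₂ᵐ (D D f)(w)` (`hasSum_ext`). A Toeplitz operator with
bounded analytic symbol multiplies the holomorphic extension by that symbol (`ext_toeplitz`), hence
this is the operator series evaluated at `w`.

Norm convergence is geometric: `‖D_{ϑ_{j,n}}‖ ≤ α⁻ⁿ`, since `(αt)ⁿ/n! ≤ e^{αt}`, and `‖T_{τ_jⁿ}‖ ≤
δⁿ` with `δ² = α² + M² - 2αε`, because `Im ψ_j > ε` and `|ψ_j| ≤ M` (`norm_I_mul_sub_le`). For large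
`α` one has `δ < α`. Boundedness of `C_φ` needs no separate argument: it is read off from `V ∘ S`.

The substantial input is the direction of Paley–Wiener from the Hardy class to the quadrant
(`HardyClass.exists_spectral`). The mean value inequality on discs bounds `F` away from the
boundary; multiplication by a Gaussian then justifies moving contours, so the Gaussian pairings of
the slices do not depend on `y`. On the frequency side this says that `e^{2π y·ξ} F̂_y(ξ)` is one
function `G`, and the uniform `L²` bound on the `e^{-2π y·ξ} G` forces `G` into `L²` of the
quadrant. Boundary values are handled through almost everywhere convergence along subsequences
(`SlicesTendsto`), which passes to products and closed relations. -/

/-! ### Fourier inversion on `L¹ ∩ L²` -/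

theorem integral_fourierInv_mul_schwartz {v : Plane → ℂ} (h1 : Integrable v) (g : 𝓢(Plane, ℂ)) :
    ∫ x, 𝓕⁻ v x * g x = ∫ x, v x * 𝓕⁻ (g : Plane → ℂ) x := by
  have hg : Integrable (fun x => g (-x)) := g.integrable.comp_neg
  have h := VectorFourier.integral_fourierIntegral_smul_eq_flip (μ := (volume : Measure Plane))
    (ν := (volume : Measure Plane)) (L := innerₗ Plane) Real.continuous_fourierChar
    continuous_inner h1 hg
  rw [← integral_neg_eq_self, flip_innerₗ] at h
  simp only [neg_neg, smul_eq_mul] at h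
  rw [Real.fourierInv_eq_fourier_comp_neg (g : Plane → ℂ)]
  simp_rw [Real.fourierInv_eq_fourier_neg v]
  exact h

open scoped ContDiff in
/-- On `L¹ ∩ L²` the inverse Fourier transform of `L²` is the inverse Fourier integral. -/
theorem coeFn_fourierInv_toLp {v : Plane → ℂ} (h1 : Integrable v) (h2 : MemLp v 2) :
    (𝓕⁻ (h2.toLp v) : L2) =ᵐ[volume] 𝓕⁻ v := by
  have hc : Continuous (𝓕⁻ v) := by
    rw [Real.fourierInv_eq_fourier_comp_neg]
    exact VectorFourier.fourierIntegral_continuous Real.continuous_fourierChar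
      (L := innerₗ Plane) continuous_inner h1.comp_neg
  refine ae_eq_of_integral_contDiff_smul_eq
    ((Lp.memLp _).locallyIntegrable (by norm_num)) hc.locallyIntegrable fun g hg hgs => ?_
  have hg₁ : HasCompactSupport (Complex.ofRealCLM ∘ g) := hgs.comp_left rfl
  have hg₂ : ContDiff ℝ ∞ (Complex.ofRealCLM ∘ g) := by fun_prop
  set G : 𝓢(Plane, ℂ) := hg₁.toSchwartzMap hg₂ with hG
  have hGg : ∀ x, G x = (g x : ℂ) := fun x => rfl
  -- The `L²` transform agrees with the transform of tempered distributions, so testing against `G`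
  -- moves `𝓕⁻` onto `G`; the lemma above does the same for the Fourier integral.
  have key := congrArg (fun T => T G) (Lp.fourierInv_toTemperedDistribution_eq (h2.toLp v))
  simp only [TemperedDistribution.fourierInv_apply, Lp.toTemperedDistribution_apply,
    smul_eq_mul] at key
  have e1 : ∀ h : Plane → ℂ, ∫ x, g x • h x = ∫ x, G x * h x := fun h => by
    simp [hGg]
  rw [e1, e1, ← key]
  simp_rw [mul_comm (G _)]
  rw [integral_fourierInv_mul_schwartz h1]
  refine integral_congr_ae ?_
  filter_upwards [h2.coeFn_toLp] with x hx
  rw [hx, mul_comm, SchwartzMap.fourierInv_coe]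

/-! ### The exponential kernel on the quadrant and the holomorphic extension -/

/-- The open quadrant `(ℝ⁺)²` of the frequency plane. -/
def quadrant : Set Plane := {ξ | ∀ j, 0 < ξ j}

theorem measurableSet_quadrant : MeasurableSet quadrant := by
  simp only [quadrant, Set.ofPred_forall]
  exact MeasurableSet.iInter fun k => measurableSet_lt measurable_const (by fun_prop)

/-- The function `ξ ↦ e^{2π i z·ξ}` on the quadrant, extended by zero. -/
def kernel (z : Fin 2 → ℂ) : Plane → ℂ :=
  quadrant.indicator fun ξ => Complex.exp (2 * Real.pi * Complex.I * ∑ j, z j * (ξ j : ℂ))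

theorem kernel_of_mem (z : Fin 2 → ℂ) {ξ : Plane} (hξ : ξ ∈ quadrant) :
    kernel z ξ = Complex.exp (2 * Real.pi * Complex.I * ∑ j, z j * (ξ j : ℂ)) :=
  Set.indicator_of_mem hξ _

theorem kernel_of_notMem (z : Fin 2 → ℂ) {ξ : Plane} (hξ : ξ ∉ quadrant) : kernel z ξ = 0 :=
  Set.indicator_of_notMem hξ _

theorem kernel_add (z w : Fin 2 → ℂ) (ξ : Plane) :
    kernel (z + w) ξ =
      Complex.exp (2 * Real.pi * Complex.I * ∑ j, z j * (ξ j : ℂ)) * kernel w ξ := by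
  by_cases hξ : ξ ∈ quadrant
  · rw [kernel_of_mem _ hξ, kernel_of_mem _ hξ, ← Complex.exp_add]
    congr 1
    simp only [Fin.sum_univ_two, Pi.add_apply]
    ring
  · rw [kernel_of_notMem _ hξ, kernel_of_notMem _ hξ, mul_zero]

theorem norm_phase (z : Fin 2 → ℂ) (ξ : Plane) :
    ‖Complex.exp (2 * Real.pi * Complex.I * ∑ j, z j * (ξ j : ℂ))‖ =
      Real.exp (-(2 * Real.pi * ∑ j, (z j).im * ξ j)) := by
  rw [Complex.norm_exp]
  congr 1
  simp [Fin.sum_univ_two]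

theorem norm_kernel_le_one {z : Fin 2 → ℂ} (hz : ∀ j, 0 ≤ (z j).im) (ξ : Plane) :
    ‖kernel z ξ‖ ≤ 1 := by
  by_cases hξ : ξ ∈ quadrant
  · rw [kernel_of_mem _ hξ, norm_phase, Real.exp_le_one_iff, neg_nonpos]
    exact mul_nonneg (by positivity)
      (Finset.sum_nonneg fun j _ => mul_nonneg (hz j) (hξ j).le)
  · simp [kernel_of_notMem _ hξ]

theorem aestronglyMeasurable_kernel (z : Fin 2 → ℂ) :
    AEStronglyMeasurable (kernel z) volume := by
  refine AEStronglyMeasurable.indicator (Continuous.aestronglyMeasurable ?_) measurableSet_quadrant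
  fun_prop

theorem integrable_prod_plane {f : Fin 2 → ℝ → ℂ} (hf : ∀ j, Integrable (f j)) :
    Integrable fun x : Plane => ∏ j, f j (x j) :=
  ((EuclideanSpace.volume_preserving_symm_measurableEquiv_toLp
    (Fin 2)).integrable_comp_emb (MeasurableEquiv.measurableEmbedding _)).2
    (Integrable.fintype_prod hf)

/-- The kernel is a product of one-variable exponentials on half-lines, each decaying because `Im
z_j > 0`. -/
theorem integrable_kernel {z : Fin 2 → ℂ} (hz : z ∈ upperHalf) : Integrable (kernel z) := by
  have h : kernel z = fun ξ : Plane => ∏ j, (Set.Ioi (0 : ℝ)).indicator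
      (fun t : ℝ => Complex.exp (2 * Real.pi * Complex.I * z j * (t : ℂ))) (ξ j) := by
    funext ξ
    by_cases hξ : ξ ∈ quadrant
    · rw [kernel_of_mem _ hξ, Finset.mul_sum, Complex.exp_sum]
      refine Finset.prod_congr rfl fun j _ => ?_
      rw [Set.indicator_of_mem (Set.mem_Ioi.2 (hξ j)), mul_assoc _ (z j)]
    · rw [kernel_of_notMem _ hξ]
      simp only [quadrant, Set.mem_ofPred_eq, not_forall] at hξ
      obtain ⟨j, hj⟩ := hξ
      exact (Finset.prod_eq_zero (Finset.mem_univ j) (Set.indicator_of_notMem hj _)).symm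
  rw [h]
  refine integrable_prod_plane fun j => ?_
  rw [integrable_indicator_iff measurableSet_Ioi]
  refine integrableOn_exp_mul_complex_Ioi ?_ 0
  have : 0 < (z j).im := hz j
  simp
  positivity

theorem memLp_kernel {z : Fin 2 → ℂ} (hz : z ∈ upperHalf) : MemLp (kernel z) 2 := by
  rw [memLp_two_iff_integrable_sq_norm (aestronglyMeasurable_kernel z)]
  refine (integrable_kernel hz).mono ((aestronglyMeasurable_kernel z).norm.pow 2)
    (Eventually.of_forall fun ξ => ?_)
  have h := norm_kernel_le_one (fun j => (hz j).le) ξ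
  rw [Real.norm_of_nonneg (by positivity)]
  nlinarith [norm_nonneg (kernel z ξ)]

/-- The function `z ↦ ∫ f̂(ξ) e^{2π i z·ξ} dξ`, integrated over the quadrant. -/
def ext (f : L2) (z : Fin 2 → ℂ) : ℂ := ∫ ξ, kernel z ξ * (𝓕 f : L2) ξ

theorem integrable_kernel_mul {z : Fin 2 → ℂ} (hz : z ∈ upperHalf) (g : L2) :
    Integrable fun ξ => kernel z ξ * g ξ :=
  (memLp_kernel hz).integrable_mul (Lp.memLp g)

/-- Evaluation at a point of `ℍ²` as a continuous functional. -/
theorem exists_evalCLM {z : Fin 2 → ℂ} (hz : z ∈ upperHalf) :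
    ∃ T : L2 →L[ℂ] ℂ, ∀ f, T f = ext f z := by
  have hk : MemLp (fun ξ => starRingEnd ℂ (kernel z ξ)) 2 := (memLp_kernel hz).star
  refine ⟨innerSL ℂ (hk.toLp _) ∘L
    (Lp.fourierTransformₗᵢ Plane ℂ).toContinuousLinearEquiv.toContinuousLinearMap, fun f => ?_⟩
  change inner ℂ (hk.toLp _) (𝓕 f : L2) = _
  rw [L2.inner_def]
  refine integral_congr_ae ?_
  filter_upwards [hk.coeFn_toLp] with ξ hξ
  rw [hξ]
  simp [mul_comm]

/-- The frequency side of the slices of `ext f`. -/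
theorem memLp_kernel_mul {z : Fin 2 → ℂ} (hz : ∀ j, 0 ≤ (z j).im) (g : L2) :
    MemLp (fun ξ => kernel z ξ * g ξ) 2 :=
  (Lp.memLp g).of_le ((aestronglyMeasurable_kernel z).mul (Lp.aestronglyMeasurable g))
    (Eventually.of_forall fun ξ => by
      rw [norm_mul]
      exact mul_le_of_le_one_left (norm_nonneg _) (norm_kernel_le_one hz ξ))

theorem point_zero_mem {y : Fin 2 → ℝ} (hy : ∀ j, 0 < y j) : point 0 y ∈ upperHalf :=
  point_mem 0 hy

theorem point_eq_add (x : Plane) (y : Fin 2 → ℝ) :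
    point x y = (fun j => ((x j : ℝ) : ℂ)) + point 0 y := by
  funext j
  simp [point]

/-- The factor `e^{2πi x·ξ}` splits off the kernel, leaving the damping `e^{-2π y·ξ}` on the
quadrant. By Plancherel, estimates on slices become estimates on the damped transform. -/
theorem slice_ext (f : L2) (y : Fin 2 → ℝ) :
    slice (ext f) y = 𝓕⁻ fun ξ => kernel (point 0 y) ξ * (𝓕 f : L2) ξ := by
  funext x
  rw [Real.fourierInv_eq']
  refine integral_congr_ae (Eventually.of_forall fun ξ => ?_)
  simp only [smul_eq_mul]
  rw [point_eq_add, kernel_add, mul_assoc]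
  congr 2
  simp [PiLp.inner_apply, Fin.sum_univ_two]
  ring

theorem slice_ext_ae {y : Fin 2 → ℝ} (hy : ∀ j, 0 < y j) (f : L2) :
    slice (ext f) y =ᵐ[volume]
      (𝓕⁻ ((memLp_kernel_mul (fun j => (point_zero_mem hy j).le) (𝓕 f)).toLp _) : L2) := by
  rw [slice_ext]
  exact (coeFn_fourierInv_toLp (integrable_kernel_mul (point_zero_mem hy) _) _).symm

theorem eLpNorm_slice_ext_le {y : Fin 2 → ℝ} (hy : ∀ j, 0 < y j) (f : L2) :
    eLpNorm (slice (ext f) y) 2 volume ≤ ‖f‖ₑ := by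
  have h0 : ∀ j, 0 ≤ (point 0 y j).im := fun j => (point_zero_mem hy j).le
  rw [eLpNorm_congr_ae (slice_ext_ae hy f), ← Lp.enorm_def]
  have h1 : ‖(𝓕⁻ ((memLp_kernel_mul h0 (𝓕 f)).toLp _) : L2)‖ₑ =
      ‖(memLp_kernel_mul h0 (𝓕 f)).toLp _‖ₑ :=
    (Lp.fourierTransformₗᵢ Plane ℂ).symm.enorm_map _
  have h2 : ‖(𝓕 f : L2)‖ₑ = ‖f‖ₑ := (Lp.fourierTransformₗᵢ Plane ℂ).enorm_map _
  rw [h1, ← h2, Lp.enorm_def, Lp.enorm_def, eLpNorm_congr_ae (MemLp.coeFn_toLp _)]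
  refine eLpNorm_mono fun ξ => ?_
  rw [norm_mul]
  exact mul_le_of_le_one_left (norm_nonneg _) (norm_kernel_le_one h0 ξ)

theorem isOpen_upperHalf : IsOpen upperHalf := by
  simp only [upperHalf, Set.ofPred_forall]
  exact isOpen_iInter_of_finite fun j =>
    isOpen_lt continuous_const (Complex.continuous_im.comp (continuous_apply j))

/-- Half of the exponential decay pays for the polynomial factor produced by differentiating the
kernel. -/
theorem mul_exp_le {t s r : ℝ} (hs : 0 < s) (hr : t * s ≤ r) :
    t * Real.exp (-(2 * r)) ≤ s⁻¹ * Real.exp (-r) := by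
  have h1 : r ≤ Real.exp r := by linarith [Real.add_one_le_exp r]
  have h2 : Real.exp (-(2 * r)) = Real.exp (-r) * Real.exp (-r) := by
    rw [← Real.exp_add]; ring_nf
  have h3 : Real.exp r * Real.exp (-r) = 1 := by rw [← Real.exp_add]; simp
  rw [h2, ← mul_assoc]
  refine mul_le_mul_of_nonneg_right ?_ (Real.exp_pos _).le
  rw [← one_div, le_div_iff₀ hs]
  nlinarith [Real.exp_pos (-r)]

theorem differentiableOn_ext (f : L2) : DifferentiableOn ℂ (ext f) upperHalf := by
  intro z₀ hz₀
  set g : L2 := 𝓕 f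
  set η : ℝ := min (z₀ 0).im (z₀ 1).im / 2 with hη
  have hη0 : 0 < η := by
    have := lt_min (hz₀ 0) (hz₀ 1)
    positivity
  -- On `s` the kernel decays at rate at least `2πη`. One half of this absorbs the factor `ξ_j` of
  -- the derivative; the other half is `|kernel w|`, which gives an integrable bound uniform in `z`.
  set w : Fin 2 → ℂ := point 0 fun _ => η / 2 with hw
  have hwm : w ∈ upperHalf := point_zero_mem fun _ => by positivity
  let s : Set (Fin 2 → ℂ) := {z | ∀ j, η < (z j).im}
  have hs : s ∈ 𝓝 z₀ := by
    refine IsOpen.mem_nhds ?_ ?_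
    · simp only [s, Set.ofPred_forall]
      exact isOpen_iInter_of_finite fun j =>
        isOpen_lt continuous_const (Complex.continuous_im.comp (continuous_apply j))
    · have h1 := min_le_left (z₀ 0).im (z₀ 1).im
      have h2 := min_le_right (z₀ 0).im (z₀ 1).im
      have h3 := lt_min (hz₀ 0) (hz₀ 1)
      intro j
      fin_cases j <;> simp [hη] <;> linarith
  let F' : (Fin 2 → ℂ) → Plane → (Fin 2 → ℂ) →L[ℂ] ℂ := fun z ξ =>
    (kernel z ξ * g ξ * (2 * Real.pi * Complex.I)) •
      ∑ j, (ξ j : ℂ) • ContinuousLinearMap.proj (R := ℂ) (φ := fun _ : Fin 2 => ℂ) j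
  refine (hasFDerivAt_integral_of_dominated_of_fderiv_le (μ := (volume : Measure Plane))
    (F := fun z ξ => kernel z ξ * g ξ) (F' := F') (s := s)
    (bound := fun ξ => (4 / η) * ‖kernel w ξ * g ξ‖) hs ?_
    (integrable_kernel_mul hz₀ g) ?_ ?_ ((integrable_kernel_mul hwm g).norm.const_mul _)
    ?_).differentiableAt.differentiableWithinAt
  · exact Eventually.of_forall fun z =>
      (aestronglyMeasurable_kernel z).mul (Lp.aestronglyMeasurable g)
  · refine (((aestronglyMeasurable_kernel z₀).mul (Lp.aestronglyMeasurable g)).mul_const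
      _).smul (Continuous.aestronglyMeasurable ?_)
    fun_prop
  · refine Eventually.of_forall fun ξ z hz => ?_
    by_cases hξ : ξ ∈ quadrant
    · have hsum : ‖∑ j, (ξ j : ℂ) • ContinuousLinearMap.proj (R := ℂ)
          (φ := fun _ : Fin 2 => ℂ) j‖ ≤ ∑ j, ξ j := by
        refine (norm_sum_le _ _).trans (Finset.sum_le_sum fun j _ => ?_)
        rw [norm_smul, Complex.norm_real, Real.norm_of_nonneg (hξ j).le]
        refine mul_le_of_le_one_right (hξ j).le ?_
        exact ContinuousLinearMap.opNorm_le_bound _ zero_le_one fun v => by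
          simpa using norm_le_pi_norm v j
      have hpos : 0 ≤ ∑ j, ξ j := Finset.sum_nonneg fun j _ => (hξ j).le
      have h2 : ‖kernel z ξ‖ ≤ Real.exp (-(2 * (Real.pi * (η * ∑ j, ξ j)))) := by
        rw [kernel_of_mem _ hξ, norm_phase, Real.exp_le_exp, neg_le_neg_iff, mul_assoc,
          Finset.mul_sum]
        have : ∑ j, η * ξ j ≤ ∑ j, (z j).im * ξ j :=
          Finset.sum_le_sum fun j _ => mul_le_mul_of_nonneg_right (hz j).le (hξ j).le
        nlinarith [Real.pi_pos]
      have h3 : ‖kernel w ξ‖ = Real.exp (-(Real.pi * (η * ∑ j, ξ j))) := by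
        rw [kernel_of_mem _ hξ, norm_phase]
        congr 1
        simp [hw, point, Fin.sum_univ_two]
        ring
      have h4 := mul_exp_le (t := (∑ j, ξ j)) (s := Real.pi * η)
        (r := Real.pi * (η * ∑ j, ξ j)) (by positivity) (le_of_eq (by ring))
      simp only [F', norm_smul, norm_mul]
      have h5 : ‖(2 : ℂ)‖ * ‖(Real.pi : ℂ)‖ * ‖Complex.I‖ = 2 * Real.pi := by
        simp [Real.pi_pos.le]
      rw [h5]
      calc ‖kernel z ξ‖ * ‖g ξ‖ * (2 * Real.pi) * _
          ≤ Real.exp (-(2 * (Real.pi * (η * ∑ j, ξ j)))) * ‖g ξ‖ * (2 * Real.pi) *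
            ∑ j, ξ j := by gcongr
        _ = ((∑ j, ξ j) * Real.exp (-(2 * (Real.pi * (η * ∑ j, ξ j))))) *
            (‖g ξ‖ * (2 * Real.pi)) := by ring
        _ ≤ ((Real.pi * η)⁻¹ * Real.exp (-(Real.pi * (η * ∑ j, ξ j)))) *
            (‖g ξ‖ * (2 * Real.pi)) := by gcongr
        _ = 2 / η * (‖kernel w ξ‖ * ‖g ξ‖) := by
            rw [h3]
            field_simp
        _ ≤ 4 / η * (‖kernel w ξ‖ * ‖g ξ‖) := by gcongr; norm_num
    · have h0 : F' z ξ = 0 := by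
        ext v
        simp [F', kernel_of_notMem _ hξ]
      rw [h0, norm_zero]
      positivity
  · refine Eventually.of_forall fun ξ z _ => ?_
    by_cases hξ : ξ ∈ quadrant
    · have h1 : HasFDerivAt (fun z : Fin 2 → ℂ => 2 * Real.pi * Complex.I * ∑ j, z j * (ξ j : ℂ))
          ((2 * Real.pi * Complex.I) •
            ∑ j, (ξ j : ℂ) • ContinuousLinearMap.proj (R := ℂ) (φ := fun _ : Fin 2 => ℂ) j) z := by
        refine HasFDerivAt.const_mul ?_ _
        refine HasFDerivAt.fun_sum fun j _ => ?_
        exact (ContinuousLinearMap.proj (R := ℂ) (φ := fun _ : Fin 2 => ℂ) j).hasFDerivAt.mul_const _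
      have h2 := (h1.cexp).mul_const (g ξ)
      simp only [kernel_of_mem _ hξ]
      convert! h2 using 1
      simp only [F', kernel_of_mem _ hξ, smul_smul]
      congr 1
      ring
    · have h0 : F' z ξ = 0 := by
        ext v
        simp [F', kernel_of_notMem _ hξ]
      simp only [h0, kernel_of_notMem _ hξ, zero_mul]
      exact hasFDerivAt_const _ _

theorem hardyClass_ext (f : L2) : HardyClass (ext f) :=
  ⟨differentiableOn_ext f, ‖f‖₊, fun _ hy => eLpNorm_slice_ext_le hy f⟩

/-! ### Functions with spectrum in the quadrant and their boundary values -/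

/-- The functions in `L²(ℝ²)` whose Fourier transform lives on the quadrant. -/
def spectral : Submodule ℂ L2 where
  carrier := {f | ∀ᵐ ξ, ξ ∉ quadrant → (𝓕 f : L2) ξ = 0}
  zero_mem' := by
    have h : (𝓕 (0 : L2) : L2) = 0 := (Lp.fourierTransformₗᵢ Plane ℂ).map_zero
    simp only [Set.mem_ofPred_eq, h]
    filter_upwards [Lp.coeFn_zero ℂ 2 (volume : Measure Plane)] with ξ _ _
    simp
  add_mem' := by
    intro f g hf hg
    have h : (𝓕 (f + g) : L2) = 𝓕 f + 𝓕 g := (Lp.fourierTransformₗᵢ Plane ℂ).map_add f g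
    simp only [Set.mem_ofPred_eq, h] at hf hg ⊢
    filter_upwards [Lp.coeFn_add (𝓕 f : L2) (𝓕 g), hf, hg] with ξ hξ h1 h2 h3
    rw [hξ, Pi.add_apply, h1 h3, h2 h3, add_zero]
  smul_mem' := by
    intro c f hf
    have h : (𝓕 (c • f) : L2) = c • 𝓕 f := (Lp.fourierTransformₗᵢ Plane ℂ).map_smul c f
    simp only [Set.mem_ofPred_eq, h] at hf ⊢
    filter_upwards [Lp.coeFn_smul c (𝓕 f : L2), hf] with ξ hξ h1 h3
    rw [hξ, Pi.smul_apply, h1 h3, smul_zero]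

theorem mem_spectral {f : L2} :
    f ∈ spectral ↔ ∀ᵐ ξ, ξ ∉ quadrant → (𝓕 f : L2) ξ = 0 := Iff.rfl

/-- Plancherel turns the claim into `∫ |kernel · f̂ - f̂|² → 0`, which is dominated convergence. Off
the quadrant the kernel is zero, so the spectral hypothesis is what makes the integrand vanish
there. -/
theorem tendsto_slice_ext {f : L2} (hf : f ∈ spectral) :
    Tendsto (fun y : Fin 2 → ℝ => eLpNorm (fun x => slice (ext f) y x - f x) 2 volume)
      (𝓝[{y | ∀ j, 0 < y j}] 0) (𝓝 0) := by
  set g : L2 := 𝓕 f with hg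
  have hmain : Tendsto (fun y : Fin 2 → ℝ =>
      (∫⁻ ξ, ‖kernel (point 0 y) ξ * g ξ - g ξ‖ₑ ^ (2 : ℝ)) ^ (1 / 2 : ℝ))
      (𝓝[{y | ∀ j, 0 < y j}] 0) (𝓝 0) := by
    have hfin : ∫⁻ ξ, ‖2 * g ξ‖ₑ ^ (2 : ℝ) ≠ ∞ :=
      (lintegral_rpow_enorm_lt_top_of_eLpNorm_lt_top (by norm_num) (by norm_num)
        ((Lp.memLp g).const_mul (2 : ℂ)).2).ne
    have h := tendsto_lintegral_filter_of_dominated_convergence' (μ := (volume : Measure Plane))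
      (l := 𝓝[{y : Fin 2 → ℝ | ∀ j, 0 < y j}] 0)
      (F := fun y ξ => ‖kernel (point 0 y) ξ * g ξ - g ξ‖ₑ ^ (2 : ℝ)) (f := fun _ => 0)
      (fun ξ => ‖2 * g ξ‖ₑ ^ (2 : ℝ)) ?_ ?_ hfin ?_
    · simpa using h.ennrpow_const (1 / 2 : ℝ)
    · exact Eventually.of_forall fun y => ((((aestronglyMeasurable_kernel _).mul
        (Lp.aestronglyMeasurable g)).sub (Lp.aestronglyMeasurable g)).enorm.pow_const _)
    · filter_upwards [self_mem_nhdsWithin] with y hy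
      refine Eventually.of_forall fun ξ => ?_
      refine ENNReal.rpow_le_rpow ?_ (by norm_num)
      rw [enorm_le_iff_norm_le]
      calc ‖kernel (point 0 y) ξ * g ξ - g ξ‖
          ≤ ‖kernel (point 0 y) ξ * g ξ‖ + ‖g ξ‖ := norm_sub_le _ _
        _ ≤ ‖g ξ‖ + ‖g ξ‖ := by
            gcongr
            rw [norm_mul]
            exact mul_le_of_le_one_left (norm_nonneg _)
              (norm_kernel_le_one (fun j => (point_zero_mem hy j).le) ξ)
        _ = ‖2 * g ξ‖ := by rw [norm_mul, Complex.norm_two, two_mul]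
    · filter_upwards [mem_spectral.1 hf] with ξ hξ
      by_cases hq : ξ ∈ quadrant
      · have hc : Continuous fun y : Fin 2 → ℝ =>
            ‖kernel (point 0 y) ξ * g ξ - g ξ‖ₑ ^ (2 : ℝ) := by
          simp only [kernel_of_mem _ hq, point]
          refine (ENNReal.continuous_rpow_const).comp (Continuous.enorm ?_)
          fun_prop
        have := (hc.tendsto 0).mono_left
          (nhdsWithin_le_nhds (s := {y : Fin 2 → ℝ | ∀ j, 0 < y j}))
        simpa [kernel_of_mem _ hq, point] using this
      · simp [hg, hξ hq]
        exact tendsto_const_nhds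
  refine hmain.congr' ?_
  filter_upwards [self_mem_nhdsWithin] with y hy
  have hL := memLp_kernel_mul (fun j => (point_zero_mem hy j).le) g
  have h1 : (fun x => slice (ext f) y x - f x) =ᵐ[volume] (𝓕⁻ (hL.toLp _ - g) : L2) := by
    have h2 : (𝓕⁻ (hL.toLp _ - g) : L2) = 𝓕⁻ (hL.toLp _) - f := by
      have h3 : (𝓕⁻ g : L2) = f := (Lp.fourierTransformₗᵢ Plane ℂ).symm_apply_apply f
      have h4 := (Lp.fourierTransformₗᵢ Plane ℂ).symm.map_sub (hL.toLp _) g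
      rw [← h3]
      exact h4
    rw [h2]
    filter_upwards [slice_ext_ae hy f, Lp.coeFn_sub (𝓕⁻ (hL.toLp _) : L2) f] with x hx hx'
    rw [hx', Pi.sub_apply, hx]
  rw [eLpNorm_congr_ae h1, ← Lp.enorm_def]
  have h5 : ‖(𝓕⁻ (hL.toLp _ - g) : L2)‖ₑ = ‖hL.toLp _ - g‖ₑ :=
    (Lp.fourierTransformₗᵢ Plane ℂ).symm.enorm_map _
  have h6 : (↑↑(hL.toLp _ - g) : Plane → ℂ) =ᵐ[volume]
      fun ξ => kernel (point 0 y) ξ * g ξ - g ξ := by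
    filter_upwards [Lp.coeFn_sub (hL.toLp _) g, hL.coeFn_toLp] with x hx hx'
    rw [hx, Pi.sub_apply, hx']
  rw [h5, Lp.enorm_def, eLpNorm_congr_ae h6,
    eLpNorm_eq_lintegral_rpow_enorm_toReal (by norm_num) (by norm_num)]
  norm_num

theorem isHardyExtension_ext {f : L2} (hf : f ∈ spectral) : IsHardyExtension (ext f) f := by
  refine ⟨hardyClass_ext f, Lp.aestronglyMeasurable f, fun R => ?_⟩
  exact tendsto_of_tendsto_of_tendsto_of_le_of_le tendsto_const_nhds (tendsto_slice_ext hf)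
    (fun _ => zero_le) fun y => eLpNorm_mono_measure _ Measure.restrict_le_self

/-! ### Mean value inequality, contour shift and Fubini -/

theorem enorm_mul_le_lintegral_circleMap {f : ℂ → ℂ} {c : ℂ} {r : ℝ} (hr : 0 < r)
    (hf : DiffContOnCl ℂ f (Metric.ball c r)) :
    ‖f c‖ₑ * ENNReal.ofReal (2 * Real.pi) ≤
      ∫⁻ θ in Set.Ioo (-Real.pi) Real.pi, ‖f (circleMap c r θ)‖ₑ := by
  have h1 : Real.circleAverage f c r = f c :=
    DiffContOnCl.circleAverage (by rwa [abs_of_pos hr])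
  -- The angle is moved to `(-π, π)`, the range used by `Complex.polarCoord`.
  rw [Real.circleAverage_eq_integral_add (-Real.pi),
    intervalIntegral.integral_comp_add_right (fun θ => f (circleMap c r θ))] at h1
  have h2 : (∫ θ in (-Real.pi)..Real.pi, f (circleMap c r θ)) = (2 * Real.pi) • f c := by
    rw [← h1, smul_smul, mul_inv_cancel₀ (by positivity), one_smul]
    ring_nf
  have h3 : ‖f c‖ₑ * ENNReal.ofReal (2 * Real.pi) = ‖(2 * Real.pi) • f c‖ₑ := by
    rw [enorm_smul, mul_comm, Real.enorm_of_nonneg (by positivity)]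
  rw [h3, ← h2, intervalIntegral.integral_of_le (by linarith [Real.pi_pos]),
    integral_Ioc_eq_integral_Ioo]
  exact enorm_integral_le_lintegral_enorm _

/-- The area of a disc, in polar coordinates. -/
def discArea (R : ℝ) : ℝ≥0∞ :=
  ∫⁻ r in Set.Ioo 0 R, ENNReal.ofReal r * ENNReal.ofReal (2 * Real.pi)

theorem discArea_ne_zero {R : ℝ} (hR : 0 < R) : discArea R ≠ 0 := by
  unfold discArea
  rw [lintegral_mul_const _ (by fun_prop)]
  refine mul_ne_zero ?_ (by simp [Real.pi_pos])
  intro h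
  rw [setLIntegral_eq_zero_iff measurableSet_Ioo (by fun_prop)] at h
  have h2 : volume (Set.Ioo (0 : ℝ) R) = 0 := by
    refine measure_mono_null (fun r hr => ?_) h
    simpa using ⟨hr.1, hr.2, hr.1⟩
  rw [Real.volume_Ioo, ENNReal.ofReal_eq_zero] at h2
  linarith

/-- The mean value inequality on circles of radius `r < R`, integrated against `r dr`. The area
stays unevaluated; only that it is nonzero and finite matters. -/
theorem enorm_mul_discArea_le {f : ℂ → ℂ} {c : ℂ} {R : ℝ}
    (hf : DifferentiableOn ℂ f (Metric.ball c R)) :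
    ‖f c‖ₑ * discArea R ≤ ∫⁻ w in Metric.ball c R, ‖f w‖ₑ := by
  have hm : Measurable ((Metric.ball c R).indicator fun w => ‖f w‖ₑ) := by
    classical
    rw [← Set.piecewise_eq_indicator]
    exact ContinuousOn.measurable_piecewise hf.continuousOn.enorm continuousOn_const
      measurableSet_ball
  rw [← lintegral_indicator measurableSet_ball,
    ← lintegral_add_left_eq_self _ c, ← Complex.lintegral_comp_polarCoord_symm]
  set G : ℝ × ℝ → ℝ≥0∞ := fun p => ENNReal.ofReal p.1 •
    (Metric.ball c R).indicator (fun w => ‖f w‖ₑ) (c + Complex.polarCoord.symm p) with hGdef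
  have hG : Measurable G := by
    simp only [hGdef, Complex.polarCoord_symm_apply, smul_eq_mul]
    refine Measurable.mul (by fun_prop) (hm.comp (by fun_prop))
  change _ ≤ ∫⁻ p in Set.Ioi (0 : ℝ) ×ˢ Set.Ioo (-Real.pi) Real.pi, G p
  rw [Measure.volume_eq_prod, ← Measure.prod_restrict, lintegral_prod _ hG.aemeasurable]
  calc ‖f c‖ₑ * discArea R
      = ∫⁻ r in Set.Ioo 0 R, ‖f c‖ₑ * (ENNReal.ofReal r * ENNReal.ofReal (2 * Real.pi)) := by
        rw [discArea, lintegral_const_mul _ (by fun_prop)]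
    _ ≤ ∫⁻ r in Set.Ioo 0 R, ∫⁻ θ in Set.Ioo (-Real.pi) Real.pi, G (r, θ) := by
        refine setLIntegral_mono' measurableSet_Ioo fun r hr => ?_
        have h := enorm_mul_le_lintegral_circleMap (c := c) hr.1
          (DifferentiableOn.diffContOnCl
            (hf.mono (Metric.closure_ball_subset_closedBall.trans
              (Metric.closedBall_subset_ball hr.2))))
        have h2 : ∀ θ : ℝ, G (r, θ) = ENNReal.ofReal r * ‖f (circleMap c r θ)‖ₑ := by
          intro θ
          have h3 : c + Complex.polarCoord.symm (r, θ) = circleMap c r θ := by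
            rw [Complex.polarCoord_symm_apply, circleMap, Complex.exp_mul_I]
            simp
          simp only [hGdef, h3, smul_eq_mul]
          rw [Set.indicator_of_mem]
          rw [Metric.mem_ball, dist_eq_norm, circleMap_sub_center, norm_circleMap_zero,
            abs_of_pos hr.1]
          exact hr.2
        simp_rw [h2]
        rw [lintegral_const_mul' _ _ ENNReal.ofReal_ne_top, mul_left_comm]
        gcongr
    _ ≤ _ := lintegral_mono_set Set.Ioo_subset_Ioi_self

/-- Cauchy's theorem on the rectangles over `[-T, T]`. The vertical sides are bounded by `g(±T) |b -
a|`; integrability of `g` does not make these vanish, so the limits of `g` are assumed. -/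
theorem integral_line_eq {f : ℂ → ℂ} {a b : ℝ} {g : ℝ → ℝ}
    (hf : DifferentiableOn ℂ f {z | z.im ∈ Set.uIcc a b})
    (hfg : ∀ x : ℝ, ∀ y ∈ Set.uIcc a b, ‖f (x + y * Complex.I)‖ ≤ g x)
    (hg : Integrable g) (hbot : Tendsto g atBot (𝓝 0)) (htop : Tendsto g atTop (𝓝 0)) :
    ∫ x : ℝ, f (x + a * Complex.I) = ∫ x : ℝ, f (x + b * Complex.I) := by
  have hi : ∀ y ∈ Set.uIcc a b, Integrable fun x : ℝ => f (x + y * Complex.I) := fun y hy => by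
    refine hg.mono' (Continuous.aestronglyMeasurable ?_) (Eventually.of_forall fun x => hfg x y hy)
    refine hf.continuousOn.comp_continuous (by fun_prop) fun x => ?_
    simpa using hy
  have hv : ∀ s : ℝ → ℝ, Tendsto (g ∘ s) atTop (𝓝 0) →
      Tendsto (fun T : ℝ => ∫ y in a..b, f (s T + y * Complex.I)) atTop (𝓝 0) := by
    intro s hs
    refine squeeze_zero_norm (a := fun T => g (s T) * |b - a|) (fun T => ?_) ?_
    · exact intervalIntegral.norm_integral_le_of_norm_le_const fun y hy =>
        hfg _ y (Set.uIoc_subset_uIcc hy)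
    · simpa using hs.mul_const |b - a|
  have h1 := intervalIntegral_tendsto_integral (hi a Set.left_mem_uIcc) tendsto_neg_atTop_atBot
    tendsto_id
  have h2 := intervalIntegral_tendsto_integral (hi b Set.right_mem_uIcc) tendsto_neg_atTop_atBot
    tendsto_id
  have h3 := hv id htop
  have h4 := hv Neg.neg (hbot.comp tendsto_neg_atTop_atBot)
  have h5 := ((h1.sub h2).add (h3.const_smul Complex.I)).sub (h4.const_smul Complex.I)
  simp only [smul_zero, add_zero, sub_zero] at h5
  rw [← sub_eq_zero]
  refine tendsto_nhds_unique h5 (tendsto_const_nhds.congr fun T => ?_)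
  have := Complex.integral_boundary_rect_eq_zero_of_differentiableOn f ⟨-T, a⟩ ⟨T, b⟩
    (hf.mono fun z hz => hz.2)
  simpa using this.symm

theorem measurePreserving_finTwo : MeasurePreserving
    (fun p : ℝ × ℝ => (WithLp.toLp 2 ![p.1, p.2] : Plane)) volume volume :=
  (EuclideanSpace.volume_preserving_symm_measurableEquiv_toLp (Fin 2)).symm.comp
    (volume_preserving_finTwoArrow ℝ).symm

theorem lintegral_plane {g : Plane → ℝ≥0∞} (hg : Measurable g) :
    ∫⁻ x, g x = ∫⁻ a : ℝ, ∫⁻ b : ℝ, g (WithLp.toLp 2 ![a, b]) := by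
  rw [← measurePreserving_finTwo.lintegral_comp hg, Measure.volume_eq_prod, lintegral_prod]
  exact (hg.comp measurePreserving_finTwo.measurable).aemeasurable

theorem integral_plane {g : Plane → ℂ} (hc : Continuous g) (hg : Integrable g) :
    Integrable (fun p : ℝ × ℝ => g (WithLp.toLp 2 ![p.1, p.2])) (volume.prod volume) ∧
    ∫ x, g x = ∫ p : ℝ × ℝ, g (WithLp.toLp 2 ![p.1, p.2]) ∂(volume.prod volume) := by
  rw [← measurePreserving_finTwo.map_eq] at hg
  refine ⟨(integrable_map_measure hc.aestronglyMeasurable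
    measurePreserving_finTwo.measurable.aemeasurable).1 hg, ?_⟩
  conv_lhs => rw [← measurePreserving_finTwo.map_eq]
  exact integral_map measurePreserving_finTwo.measurable.aemeasurable hc.aestronglyMeasurable

theorem lintegral_enorm_sq {f : Plane → ℂ} {μ : Measure Plane} :
    ∫⁻ x, ‖f x‖ₑ ^ 2 ∂μ = eLpNorm f 2 μ ^ 2 := by
  have := eLpNorm_nnreal_pow_eq_lintegral (f := f) (μ := μ) (p := 2) (by norm_num)
  simpa using this.symm

/-- The disc is enlarged to the horizontal strip containing it, because the Hardy norm controls
integrals over full horizontal lines. -/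
theorem setLIntegral_ball_le {g : ℂ → ℝ≥0∞} (hg : Measurable g) (z : ℂ) (R : ℝ) :
    ∫⁻ w in Metric.ball z R, g w ≤
      ∫⁻ y in Set.Ioo (z.im - R) (z.im + R), ∫⁻ x : ℝ, g (x + y * Complex.I) := by
  have h1 : ∫⁻ w in Metric.ball z R, g w ≤
      ∫⁻ w : ℂ, (Set.Ioo (z.im - R) (z.im + R)).indicator (fun _ => g w) w.im := by
    rw [← lintegral_indicator measurableSet_ball]
    refine lintegral_mono fun w => ?_
    by_cases hw : w ∈ Metric.ball z R
    · rw [Set.indicator_of_mem hw, Set.indicator_of_mem]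
      have h2 := (Complex.abs_im_le_norm (w - z)).trans_lt (mem_ball_iff_norm.1 hw)
      rw [Complex.sub_im, abs_lt] at h2
      constructor <;> linarith
    · rw [Set.indicator_of_notMem hw]
      exact zero_le
  refine h1.trans (le_of_eq ?_)
  rw [← (Complex.volume_preserving_equiv_real_prod.symm).lintegral_comp_emb
    Complex.measurableEquivRealProd.symm.measurableEmbedding, Measure.volume_eq_prod,
    lintegral_prod_symm]
  · rw [← lintegral_indicator measurableSet_Ioo]
    refine lintegral_congr fun y => ?_
    by_cases hy : y ∈ Set.Ioo (z.im - R) (z.im + R)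
    · simp only [Complex.measurableEquivRealProd_symm_apply, Set.indicator_of_mem hy]
      refine lintegral_congr fun x => ?_
      congr 1
      apply Complex.ext <;> simp
    · simp [Complex.measurableEquivRealProd_symm_apply, Set.indicator_of_notMem hy]
  · refine Measurable.aemeasurable ?_
    have : Measurable fun w : ℂ =>
        (Complex.im ⁻¹' Set.Ioo (z.im - R) (z.im + R)).indicator g w :=
      hg.indicator (Complex.measurable_im measurableSet_Ioo)
    exact this.comp Complex.measurableEquivRealProd.symm.measurable

theorem differentiableOn_section {F : (Fin 2 → ℂ) → ℂ} (hF : DifferentiableOn ℂ F upperHalf)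
    (z : Fin 2 → ℂ) (j : Fin 2) (hz : ∀ k ≠ j, 0 < (z k).im) :
    DifferentiableOn ℂ (fun w => F (Function.update z j w)) {w | 0 < w.im} := by
  refine hF.comp (f := fun w => Function.update z j w) (Differentiable.differentiableOn ?_) ?_
  · rw [differentiable_pi]
    intro k
    by_cases hk : k = j
    · subst hk
      simp
    · simp [Function.update_of_ne hk]
  · intro w hw k
    by_cases hk : k = j
    · subst hk
      simpa using hw
    · simpa [Function.update_of_ne hk] using hz k hk

theorem update_zero (z : Fin 2 → ℂ) (w : ℂ) : Function.update z 0 w = ![w, z 1] := by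
  funext j; fin_cases j <;> simp

theorem update_one (z : Fin 2 → ℂ) (w : ℂ) : Function.update z 1 w = ![z 0, w] := by
  funext j; fin_cases j <;> simp

theorem ball_subset_upper {z : ℂ} {R : ℝ} (h : R ≤ z.im) :
    Metric.ball z R ⊆ {w | 0 < w.im} := fun w hw => by
  have h2 := (Complex.abs_im_le_norm (w - z)).trans_lt (mem_ball_iff_norm.1 hw)
  rw [Complex.sub_im, abs_lt] at h2
  simp only [Set.mem_ofPred_eq]
  linarith

theorem discArea_ne_top (R : ℝ) : discArea R ≠ ∞ := by
  refine ne_top_of_le_ne_top ?_ (setLIntegral_mono' (μ := volume)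
    (g := fun _ => ENNReal.ofReal R * ENNReal.ofReal (2 * Real.pi))
    measurableSet_Ioo fun r hr => mul_le_mul_left (ENNReal.ofReal_le_ofReal hr.2.le) _)
  rw [setLIntegral_const, Real.volume_Ioo]
  exact ENNReal.mul_ne_top (ENNReal.mul_ne_top ENNReal.ofReal_ne_top ENNReal.ofReal_ne_top)
    ENNReal.ofReal_ne_top

/-- A function in the Hardy class is bounded away from the boundary. -/
theorem HardyClass.exists_bound {F : (Fin 2 → ℂ) → ℂ} (hF : HardyClass F) {η : ℝ} (hη : 0 < η) :
    ∃ C : ℝ, 0 ≤ C ∧ ∀ z : Fin 2 → ℂ, (∀ j, η ≤ (z j).im) → ‖F z‖ ≤ C := by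
  obtain ⟨hd, M, hM⟩ := hF
  set κ := discArea η with hκ
  have hκ0 : κ ≠ 0 := discArea_ne_zero hη
  set A : (Fin 2 → ℂ) → ℝ≥0∞ := upperHalf.indicator fun z => ‖F z‖ₑ ^ 2 with hA
  have hAm : Measurable A := by
    classical
    rw [hA, ← Set.piecewise_eq_indicator]
    refine ContinuousOn.measurable_piecewise ?_ continuousOn_const
      isOpen_upperHalf.measurableSet
    exact (ENNReal.continuous_pow 2).comp_continuousOn hd.continuousOn.enorm
  have hAF : ∀ z ∈ upperHalf, A z = ‖F z‖ₑ ^ 2 := fun z hz => Set.indicator_of_mem hz _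
  -- The mean value inequality in one variable, applied to the holomorphic function `F²`. Used in
  -- both variables it bounds `|F(z)|²` by an integral over a product of two discs.
  have hsq : ∀ z ∈ upperHalf, ∀ j, η ≤ (z j).im →
      A z * κ ≤ ∫⁻ w in Metric.ball (z j) η, A (Function.update z j w) := by
    intro z hz j hj
    have h1 := differentiableOn_section hd z j fun k _ => hz k
    have h2 := enorm_mul_discArea_le (((h1.fun_pow 2)).mono (ball_subset_upper hj))
    simp only [Function.update_eq_self] at h2
    rw [hAF z hz]
    refine (le_of_eq (by rw [enorm_pow])).trans (h2.trans
      (setLIntegral_mono' measurableSet_ball fun w hw => ?_))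
    rw [hAF, enorm_pow]
    intro k
    by_cases hk : k = j
    · subst hk
      simpa using ball_subset_upper hj hw
    · simpa [Function.update_of_ne hk] using hz k
  have hslice : ∀ s t : ℝ, 0 < s → 0 < t →
      ∫⁻ a : ℝ, ∫⁻ b : ℝ, A ![a + s * Complex.I, b + t * Complex.I] ≤ (M : ℝ≥0∞) ^ 2 := by
    intro s t hs ht
    have hy : ∀ j, 0 < ![s, t] j := by
      intro j; fin_cases j <;> simp [hs, ht]
    refine le_trans (le_of_eq ?_) (pow_le_pow_left' (hM ![s, t] hy) 2)
    rw [← lintegral_enorm_sq]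
    have h1 : ∀ x, ‖slice F ![s, t] x‖ₑ ^ 2 = A (point x ![s, t]) := fun x =>
      (hAF _ (point_mem x hy)).symm
    simp_rw [h1]
    rw [lintegral_plane (g := fun x => A (point x ![s, t]))
      (hAm.comp (continuous_point _).measurable)]
    refine lintegral_congr fun a => lintegral_congr fun b => ?_
    congr 1
    funext j
    fin_cases j <;> simp [point]
  set B : ℝ≥0∞ := ENNReal.ofReal (2 * η) * (ENNReal.ofReal (2 * η) * (M : ℝ≥0∞) ^ 2) with hB
  have hκt : κ ≠ ∞ := discArea_ne_top η
  have hBt : B ≠ ∞ := by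
    rw [hB]
    exact ENNReal.mul_ne_top ENNReal.ofReal_ne_top
      (ENNReal.mul_ne_top ENNReal.ofReal_ne_top (by simp))
  have hmain : ∀ z : Fin 2 → ℂ, (∀ j, η ≤ (z j).im) → ‖F z‖ₑ ^ 2 ≤ B / κ / κ := by
    intro z hz
    have hzu : z ∈ upperHalf := fun j => hη.trans_le (hz j)
    rw [ENNReal.le_div_iff_mul_le (Or.inl hκ0) (Or.inl hκt),
      ENNReal.le_div_iff_mul_le (Or.inl hκ0) (Or.inl hκt), ← hAF z hzu]
    have h1 : A z * κ * κ ≤ ∫⁻ w in Metric.ball (z 0) η, ∫⁻ v in Metric.ball (z 1) η, A ![w, v] := by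
      refine (mul_le_mul_left (hsq z hzu 0 (hz 0)) κ).trans ?_
      rw [← lintegral_mul_const' _ _ hκt]
      refine setLIntegral_mono' measurableSet_ball fun w hw => ?_
      have h2 := hsq (Function.update z 0 w) ?_ 1 (by simpa using hz 1)
      · refine h2.trans (le_of_eq ?_)
        simp [update_zero, update_one]
      · intro k
        fin_cases k
        · simpa using ball_subset_upper (hz 0) hw
        · simpa using hzu 1
    refine h1.trans ?_
    have hpair : ∀ {X : Type} [MeasurableSpace X] (u v : X → ℂ), Measurable u → Measurable v →
        Measurable fun p => A ![u p, v p] := by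
      intro X _ u v hu hv
      refine hAm.comp (measurable_pi_iff.2 fun j => ?_)
      fin_cases j
      · simpa using hu
      · simpa using hv
    have hQ : Measurable fun p : ℂ × ℝ => ∫⁻ b : ℝ, A ![p.1, b + p.2 * Complex.I] :=
      Measurable.lintegral_prod_right' (f := fun q : (ℂ × ℝ) × ℝ =>
        A ![q.1.1, q.2 + q.1.2 * Complex.I]) (hpair _ _ (by fun_prop) (by fun_prop))
    set I₀ := Set.Ioo ((z 0).im - η) ((z 0).im + η) with hI₀
    set I₁ := Set.Ioo ((z 1).im - η) ((z 1).im + η) with hI₁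
    have hvol : ∀ j, volume (Set.Ioo ((z j).im - η) ((z j).im + η)) = ENNReal.ofReal (2 * η) :=
      fun j => by rw [Real.volume_Ioo]; ring_nf
    calc ∫⁻ w in Metric.ball (z 0) η, ∫⁻ v in Metric.ball (z 1) η, A ![w, v]
        ≤ ∫⁻ w in Metric.ball (z 0) η, ∫⁻ t in I₁, ∫⁻ b : ℝ, A ![w, b + t * Complex.I] :=
          lintegral_mono fun w => setLIntegral_ball_le (g := fun v => A ![w, v])
            (hpair _ _ (by fun_prop) (by fun_prop)) _ _
      _ ≤ ∫⁻ s in I₀, ∫⁻ a : ℝ, ∫⁻ t in I₁, ∫⁻ b : ℝ,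
            A ![a + s * Complex.I, b + t * Complex.I] :=
          setLIntegral_ball_le (g := fun w => ∫⁻ t in I₁, ∫⁻ b : ℝ, A ![w, b + t * Complex.I])
            hQ.lintegral_prod_right' _ _
      _ = ∫⁻ s in I₀, ∫⁻ t in I₁, ∫⁻ a : ℝ, ∫⁻ b : ℝ,
            A ![a + s * Complex.I, b + t * Complex.I] := by
          refine lintegral_congr fun s => lintegral_lintegral_swap ?_
          exact (hQ.comp (g := fun p : ℂ × ℝ => ∫⁻ b : ℝ, A ![p.1, b + p.2 * Complex.I])
            (f := fun p : ℝ × ℝ => ((p.1 : ℂ) + s * Complex.I, p.2)) (by fun_prop)).aemeasurable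
      _ ≤ ∫⁻ s in I₀, ∫⁻ t in I₁, (M : ℝ≥0∞) ^ 2 := by
          refine setLIntegral_mono' measurableSet_Ioo fun s hs =>
            setLIntegral_mono' measurableSet_Ioo fun t ht => hslice s t ?_ ?_
          · linarith [hs.1, hz 0]
          · linarith [ht.1, hz 1]
      _ = B := by
          simp only [lintegral_const, Measure.restrict_apply_univ, hvol, hI₀, hI₁, hB]
          ring
  -- Adding `1` avoids a square root, since `a ≤ a² + 1`.
  refine ⟨((B / κ / κ).toReal + 1), by positivity, fun z hz => ?_⟩
  have h2 := hmain z hz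
  have h3 : B / κ / κ ≠ ∞ := ENNReal.div_ne_top (ENNReal.div_ne_top hBt hκ0) hκ0
  have h4 := ENNReal.toReal_mono h3 h2
  rw [ENNReal.toReal_pow, toReal_enorm] at h4
  nlinarith [norm_nonneg (F z), sq_nonneg (‖F z‖ - 1)]

/-! ### Gaussian pairings of the slices -/

/-- The Gaussian `z ↦ exp (-π (z - c)²)`. -/
def gauss (c : Plane) (z : Fin 2 → ℂ) : ℂ :=
  Complex.exp (-Real.pi * ∑ j, (z j - (c j : ℂ)) ^ 2)

theorem differentiable_gauss (c : Plane) : Differentiable ℂ (gauss c) := by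
  unfold gauss
  fun_prop

theorem norm_gauss (c : Plane) (z : Fin 2 → ℂ) :
    ‖gauss c z‖ = Real.exp (Real.pi * ∑ j, (z j).im ^ 2) *
      ∏ j, Real.exp (-Real.pi * ((z j).re - c j) ^ 2) := by
  rw [gauss, Complex.norm_exp, ← Real.exp_sum, ← Real.exp_add]
  congr 1
  simp [Fin.sum_univ_two, pow_two]
  ring

theorem integrable_gaussian_sub (c : ℝ) :
    Integrable fun x : ℝ => Real.exp (-Real.pi * (x - c) ^ 2) :=
  (integrable_exp_neg_mul_sq Real.pi_pos).comp_sub_right c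

theorem tendsto_gaussian_sub {l : Filter ℝ} {c : ℝ} (h : Tendsto (fun x => |x - c|) l atTop) :
    Tendsto (fun x : ℝ => Real.exp (-Real.pi * (x - c) ^ 2)) l (𝓝 0) := by
  refine Real.tendsto_exp_atBot.comp ?_
  have h2 : Tendsto (fun x : ℝ => |x - c| ^ 2) l atTop :=
    (tendsto_pow_atTop two_ne_zero).comp h
  simp_rw [sq_abs] at h2
  exact h2.const_mul_atTop_of_neg (by linarith [Real.pi_pos])

theorem integrable_gaussian_plane (c : Plane) :
    Integrable fun x : Plane => ∏ j, Real.exp (-Real.pi * (x j - c j) ^ 2) := by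
  have h := integrable_prod_plane (f := fun j t => (Real.exp (-Real.pi * (t - c j) ^ 2) : ℂ))
    fun j => (integrable_gaussian_sub (c j)).ofReal
  refine h.norm.congr (Eventually.of_forall fun x => ?_)
  simp [Fin.prod_univ_two, -Complex.ofReal_exp]

theorem HardyClass.integrable_mul_gauss {F : (Fin 2 → ℂ) → ℂ} (hF : HardyClass F) (c : Plane)
    {y : Fin 2 → ℝ} (hy : ∀ j, 0 < y j) :
    Continuous (fun x => F (point x y) * gauss c (point x y)) ∧
    Integrable fun x => F (point x y) * gauss c (point x y) := by
  have hc : Continuous (fun x => F (point x y) * gauss c (point x y)) :=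
    (hF.1.continuousOn.comp_continuous (continuous_point y) fun x => point_mem x hy).mul
      ((differentiable_gauss c).continuous.comp (continuous_point y))
  obtain ⟨C, hC0, hC⟩ := hF.exists_bound (lt_min (hy 0) (hy 1))
  refine ⟨hc, ((integrable_gaussian_plane c).const_mul
    (C * Real.exp (Real.pi * ∑ j, y j ^ 2))).mono' hc.aestronglyMeasurable
    (Eventually.of_forall fun x => ?_)⟩
  rw [norm_mul, norm_gauss, mul_assoc]
  have h1 : ‖F (point x y)‖ ≤ C := hC _ fun j => by
    fin_cases j <;> simp [point]
  simp only [point, Complex.add_re, Complex.add_im, Complex.ofReal_re, Complex.ofReal_im,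
    Complex.mul_re, Complex.mul_im, Complex.I_re, Complex.I_im, mul_zero, mul_one, sub_zero,
    zero_add, add_zero]
  exact mul_le_mul_of_nonneg_right h1 (by positivity)

/-- Contour shift in one variable. -/
theorem HardyClass.integral_section_eq {F : (Fin 2 → ℂ) → ℂ} (hF : HardyClass F) (c : Plane)
    (z : Fin 2 → ℂ) (j : Fin 2) (hz : ∀ k ≠ j, 0 < (z k).im) {s t : ℝ} (hs : 0 < s) (ht : 0 < t) :
    ∫ x : ℝ, F (Function.update z j (x + s * Complex.I)) *
        gauss c (Function.update z j (x + s * Complex.I)) =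
      ∫ x : ℝ, F (Function.update z j (x + t * Complex.I)) *
        gauss c (Function.update z j (x + t * Complex.I)) := by
  have hst : 0 < min s t := lt_min hs ht
  obtain ⟨η, hη, hη1, hη2⟩ : ∃ η : ℝ, 0 < η ∧ η ≤ min s t ∧ ∀ k ≠ j, η ≤ (z k).im := by
    obtain ⟨η, hη, hη2⟩ : ∃ η : ℝ, 0 < η ∧ ∀ k ≠ j, η ≤ (z k).im := by
      -- In `Fin 2`, `1 - j` is the other coordinate, the one that stays fixed.
      refine ⟨(z (1 - j)).im, hz _ ?_, fun k hk => le_of_eq ?_⟩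
      · fin_cases j <;> simp
      · fin_cases j <;> fin_cases k <;> simp_all
    exact ⟨min η (min s t), lt_min hη hst, min_le_right _ _,
      fun k hk => (min_le_left _ _).trans (hη2 k hk)⟩
  obtain ⟨C, hC0, hC⟩ := hF.exists_bound hη
  -- Along the contour the Gaussian grows like `e^{π u²}` in the height `u`; since `u` lies between
  -- `s` and `t`, the term `s² + t²` dominates `u²`.
  set D : ℝ := C * (Real.exp (Real.pi * (∑ k, (z k).im ^ 2 + (s ^ 2 + t ^ 2)))) with hD
  refine integral_line_eq (f := fun w => F (Function.update z j w) * gauss c (Function.update z j w))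
    (g := fun x => D * Real.exp (-Real.pi * (x - c j) ^ 2)) ?_ ?_
    ((integrable_gaussian_sub _).const_mul _) ?_ ?_
  · refine ((differentiableOn_section hF.1 z j hz).mono fun w hw => ?_).mul
      ((differentiable_gauss c).comp ?_).differentiableOn
    · exact hst.trans_le hw.1
    · rw [differentiable_pi]
      intro k
      by_cases hk : k = j
      · subst hk
        simp
      · simp [Function.update_of_ne hk]
  · intro x u hu
    have hu0 : 0 < u := hst.trans_le hu.1
    have hu2 : u ^ 2 ≤ s ^ 2 + t ^ 2 := by
      rcases le_max_iff.1 hu.2 with h | h <;> nlinarith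
    have hF1 : ‖F (Function.update z j (x + u * Complex.I))‖ ≤ C := hC _ fun k => by
      by_cases hk : k = j
      · subst hk
        simpa using hη1.trans hu.1
      · simpa [Function.update_of_ne hk] using hη2 k hk
    have hg : ‖gauss c (Function.update z j (x + u * Complex.I))‖ ≤
        Real.exp (Real.pi * (∑ k, (z k).im ^ 2 + (s ^ 2 + t ^ 2))) *
          Real.exp (-Real.pi * (x - c j) ^ 2) := by
      rw [norm_gauss]
      refine mul_le_mul ?_ ?_ (by positivity) (by positivity)
      · rw [Real.exp_le_exp]
        refine mul_le_mul_of_nonneg_left ?_ Real.pi_pos.le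
        have h5 := sq_nonneg (z 0).im
        have h6 := sq_nonneg (z 1).im
        fin_cases j <;> simp [Fin.sum_univ_two] <;> linarith
      · have h7 : ∀ v : ℝ, Real.exp (-Real.pi * v ^ 2) ≤ 1 := fun v => by
          rw [Real.exp_le_one_iff]
          nlinarith [Real.pi_pos, sq_nonneg v]
        fin_cases j
        · simp only [Fin.prod_univ_two]
          simpa using mul_le_of_le_one_right (Real.exp_pos _).le (h7 ((z 1).re - c 1))
        · simp only [Fin.prod_univ_two]
          simpa using mul_le_of_le_one_left (Real.exp_pos _).le (h7 ((z 0).re - c 0))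
    rw [norm_mul, hD, mul_assoc]
    exact mul_le_mul hF1 hg (norm_nonneg _) hC0
  · rw [← mul_zero D]
    refine (tendsto_gaussian_sub (tendsto_abs_atBot_atTop.comp ?_)).const_mul D
    exact tendsto_atBot_add_const_right _ _ tendsto_id
  · rw [← mul_zero D]
    refine (tendsto_gaussian_sub (tendsto_abs_atTop_atTop.comp ?_)).const_mul D
    exact tendsto_atTop_add_const_right _ _ tendsto_id

theorem point_toLp (a b s t : ℝ) :
    point (WithLp.toLp 2 ![a, b]) ![s, t] = ![a + s * Complex.I, b + t * Complex.I] := by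
  funext j
  fin_cases j <;> simp [point]

/-- The pairing of the slices with a Gaussian does not depend on the slice. -/
theorem HardyClass.integral_mul_gauss_eq {F : (Fin 2 → ℂ) → ℂ} (hF : HardyClass F) (c : Plane)
    {y y' : Fin 2 → ℝ} (hy : ∀ j, 0 < y j) (hy' : ∀ j, 0 < y' j) :
    ∫ x, F (point x y) * gauss c (point x y) = ∫ x, F (point x y') * gauss c (point x y') := by
  have hpos : ∀ {s t : ℝ}, 0 < s → 0 < t → ∀ j, 0 < ![s, t] j := by
    intro s t hs ht j
    fin_cases j <;> simp [hs, ht]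
  have hvec : ∀ y : Fin 2 → ℝ, y = ![y 0, y 1] := fun y => by
    funext j; fin_cases j <;> simp
  have h1 : ∀ s s' t : ℝ, 0 < s → 0 < s' → 0 < t →
      ∫ x, F (point x ![s, t]) * gauss c (point x ![s, t]) =
        ∫ x, F (point x ![s', t]) * gauss c (point x ![s', t]) := by
    intro s s' t hs hs' ht
    obtain ⟨a1, a2⟩ := hF.integrable_mul_gauss c (hpos hs ht)
    obtain ⟨b1, b2⟩ := hF.integrable_mul_gauss c (hpos hs' ht)
    rw [(integral_plane a1 a2).2, (integral_plane b1 b2).2,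
      integral_prod_symm _ (integral_plane a1 a2).1, integral_prod_symm _ (integral_plane b1 b2).1]
    refine integral_congr_ae (Eventually.of_forall fun b => ?_)
    have := hF.integral_section_eq c ![0, b + t * Complex.I] 0 (fun k hk => ?_) hs hs'
    · simpa only [point_toLp, update_zero, Matrix.cons_val_one, Matrix.cons_val_fin_one] using this
    · fin_cases k
      · simp at hk
      · simpa using ht
  have h2 : ∀ s t t' : ℝ, 0 < s → 0 < t → 0 < t' →
      ∫ x, F (point x ![s, t]) * gauss c (point x ![s, t]) =
        ∫ x, F (point x ![s, t']) * gauss c (point x ![s, t']) := by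
    intro s t t' hs ht ht'
    obtain ⟨a1, a2⟩ := hF.integrable_mul_gauss c (hpos hs ht)
    obtain ⟨b1, b2⟩ := hF.integrable_mul_gauss c (hpos hs ht')
    rw [(integral_plane a1 a2).2, (integral_plane b1 b2).2,
      integral_prod _ (integral_plane a1 a2).1, integral_prod _ (integral_plane b1 b2).1]
    refine integral_congr_ae (Eventually.of_forall fun a => ?_)
    have := hF.integral_section_eq c ![a + s * Complex.I, 0] 1 (fun k hk => ?_) ht ht'
    · simpa only [point_toLp, update_one, Matrix.cons_val_zero] using this
    · fin_cases k
      · simpa using hs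
      · simp at hk
  rw [hvec y, hvec y', h1 _ (y' 0) _ (hy 0) (hy' 0) (hy 1), h2 _ _ _ (hy' 0) (hy 1) (hy' 1)]

theorem HardyClass.memLp_slice {F : (Fin 2 → ℂ) → ℂ} (hF : HardyClass F) {y : Fin 2 → ℝ}
    (hy : ∀ j, 0 < y j) : MemLp (slice F y) 2 := by
  obtain ⟨hd, M, hM⟩ := hF
  exact ⟨HardyClass.aestronglyMeasurable_slice hd hy _, (hM y hy).trans_lt ENNReal.coe_lt_top⟩

/-- A Gaussian on the frequency side, the Fourier transform of a slice of `gauss c`. -/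
def freqGauss (c : Plane) (y : Fin 2 → ℝ) (ξ : Plane) : ℂ :=
  Complex.exp (-Real.pi * ∑ j, (ξ j : ℂ) ^ 2 +
    ∑ j, 2 * Real.pi * ((y j : ℂ) - Complex.I * (c j : ℂ)) * (ξ j : ℂ))

theorem continuous_freqGauss (c : Plane) (y : Fin 2 → ℝ) : Continuous (freqGauss c y) := by
  unfold freqGauss
  fun_prop

theorem norm_freqGauss (c : Plane) (y : Fin 2 → ℝ) (ξ : Plane) :
    ‖freqGauss c y ξ‖ = Real.exp (Real.pi * ∑ j, y j ^ 2) *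
      ∏ j, Real.exp (-Real.pi * (ξ j - (WithLp.toLp 2 y : Plane) j) ^ 2) := by
  rw [freqGauss, Complex.norm_exp, ← Real.exp_sum, ← Real.exp_add]
  congr 1
  simp [Fin.sum_univ_two, pow_two]
  ring

theorem norm_freqGauss_le (c : Plane) (y : Fin 2 → ℝ) (ξ : Plane) :
    ‖freqGauss c y ξ‖ ≤ Real.exp (Real.pi * ∑ j, y j ^ 2) := by
  rw [norm_freqGauss]
  refine mul_le_of_le_one_right (Real.exp_pos _).le
    (Finset.prod_le_one (fun j _ => (Real.exp_pos _).le) fun j _ => ?_)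
  rw [Real.exp_le_one_iff]
  nlinarith [Real.pi_pos, sq_nonneg (ξ j - (WithLp.toLp 2 y : Plane) j)]

theorem integrable_freqGauss (c : Plane) (y : Fin 2 → ℝ) : Integrable (freqGauss c y) := by
  refine ((integrable_gaussian_plane (WithLp.toLp 2 y)).const_mul
    (Real.exp (Real.pi * ∑ j, y j ^ 2))).mono' (continuous_freqGauss c y).aestronglyMeasurable
    (Eventually.of_forall fun ξ => (norm_freqGauss c y ξ).le)

theorem memLp_freqGauss (c : Plane) (y : Fin 2 → ℝ) : MemLp (freqGauss c y) 2 := by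
  rw [memLp_two_iff_integrable_sq_norm (continuous_freqGauss c y).aestronglyMeasurable]
  refine ((integrable_freqGauss c y).norm.const_mul (Real.exp (Real.pi * ∑ j, y j ^ 2))).mono'
    ((continuous_freqGauss c y).norm.pow 2).aestronglyMeasurable
    (Eventually.of_forall fun ξ => ?_)
  rw [Real.norm_of_nonneg (by positivity), pow_two]
  exact mul_le_mul_of_nonneg_right (norm_freqGauss_le c y ξ) (norm_nonneg _)

/-- Completing the square in the Gaussian integral. The conjugate is the form needed for Parseval,
as the inner product is conjugate-linear in its first argument. -/
theorem fourierInv_freqGauss (c : Plane) (y : Fin 2 → ℝ) (x : Plane) :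
    𝓕⁻ (freqGauss c y) x = starRingEnd ℂ (gauss c (point x y)) := by
  rw [Real.fourierInv_eq']
  have h := GaussianFourier.integral_cexp_neg_mul_sum_add (b := (Real.pi : ℂ)) (by simp [Real.pi_pos])
    fun j : Fin 2 => 2 * Real.pi * ((y j : ℂ) + Complex.I * ((x j : ℂ) - (c j : ℂ)))
  rw [← (EuclideanSpace.volume_preserving_symm_measurableEquiv_toLp (Fin 2)).integral_comp
    (MeasurableEquiv.measurableEmbedding _)] at h
  rw [div_self (by simp [Real.pi_ne_zero]), Complex.one_cpow, one_mul] at h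
  have hpi : (Real.pi : ℂ) ≠ 0 := by simp [Real.pi_ne_zero]
  refine Eq.trans (integral_congr_ae (Eventually.of_forall fun ξ => ?_)) (h.trans ?_)
  · simp only [freqGauss, smul_eq_mul]
    rw [← Complex.exp_add]
    congr 1
    simp [PiLp.inner_apply, Fin.sum_univ_two]
    ring
  · rw [gauss, ← Complex.exp_conj]
    congr 1
    simp only [Fin.sum_univ_two, point, map_mul, map_neg, map_add, map_sub, map_pow,
      Complex.conj_ofReal, Complex.conj_I]
    field_simp
    ring_nf
    simp only [Complex.I_sq]
    ring

/-- Parseval, with the centre `c` entering `freqGauss` only through a phase. As `c` varies, the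
pairings therefore fill out an inverse Fourier transform, which can be inverted. -/
theorem integral_slice_mul_gauss {F : (Fin 2 → ℂ) → ℂ} (hF : HardyClass F) (c : Plane)
    {y : Fin 2 → ℝ} (hy : ∀ j, 0 < y j) :
    ∫ x, F (point x y) * gauss c (point x y) =
      𝓕⁻ (fun ξ => freqGauss 0 y ξ * (𝓕 ((hF.memLp_slice hy).toLp _) : L2) ξ) c := by
  set φ : L2 := (hF.memLp_slice hy).toLp _ with hφ
  set w : L2 := (memLp_freqGauss c y).toLp _ with hw
  have h1 : inner ℂ (𝓕⁻ w : L2) φ = inner ℂ w (𝓕 φ : L2) := by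
    rw [← Lp.inner_fourier_eq (𝓕⁻ w : L2) φ, FourierTransform.fourier_fourierInv_eq]
  rw [L2.inner_def, L2.inner_def] at h1
  have h2 : ∫ x, F (point x y) * gauss c (point x y) =
      ∫ x, inner ℂ ((𝓕⁻ w : L2) x) (φ x) := by
    refine integral_congr_ae ?_
    filter_upwards [coeFn_fourierInv_toLp (integrable_freqGauss c y) (memLp_freqGauss c y),
      (hF.memLp_slice hy).coeFn_toLp] with x hx hx'
    rw [hx, hx', fourierInv_freqGauss]
    simp [slice]
  rw [h2, h1, Real.fourierInv_eq']
  refine integral_congr_ae ?_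
  filter_upwards [(memLp_freqGauss c y).coeFn_toLp] with ξ hξ
  rw [hξ]
  simp only [RCLike.inner_apply, smul_eq_mul]
  rw [← mul_assoc, mul_comm]
  congr 1
  rw [freqGauss, freqGauss, ← Complex.exp_conj, ← Complex.exp_add]
  congr 1
  simp [PiLp.inner_apply, Fin.sum_univ_two, map_ofNat]
  ring

theorem integrable_freqGauss_mul (c : Plane) (y : Fin 2 → ℝ) (g : L2) :
    Integrable fun ξ => freqGauss c y ξ * g ξ :=
  (memLp_freqGauss c y).integrable_mul (Lp.memLp g)

theorem memLp_freqGauss_mul (c : Plane) (y : Fin 2 → ℝ) (g : L2) :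
    MemLp (fun ξ => freqGauss c y ξ * g ξ) 2 :=
  (Lp.memLp g).of_le_mul (c := Real.exp (Real.pi * ∑ j, y j ^ 2))
    ((continuous_freqGauss c y).aestronglyMeasurable.mul (Lp.aestronglyMeasurable g))
    (Eventually.of_forall fun ξ => by
      rw [norm_mul]
      exact mul_le_mul_of_nonneg_right (norm_freqGauss_le c y ξ) (norm_nonneg _))

/-- The Fourier transforms of the slices differ by exponential factors. -/
theorem HardyClass.exp_mul_fourier_slice {F : (Fin 2 → ℂ) → ℂ} (hF : HardyClass F)
    {y y' : Fin 2 → ℝ} (hy : ∀ j, 0 < y j) (hy' : ∀ j, 0 < y' j) :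
    ∀ᵐ ξ : Plane, (𝓕 ((hF.memLp_slice hy).toLp _) : L2) ξ =
      Real.exp (2 * Real.pi * ∑ j, (y' j - y j) * ξ j) *
        (𝓕 ((hF.memLp_slice hy').toLp _) : L2) ξ := by
  set g : L2 := 𝓕 ((hF.memLp_slice hy).toLp _)
  set g' : L2 := 𝓕 ((hF.memLp_slice hy').toLp _)
  have h1 : 𝓕⁻ (fun ξ => freqGauss 0 y ξ * g ξ) = 𝓕⁻ (fun ξ => freqGauss 0 y' ξ * g' ξ) := by
    funext c
    rw [← integral_slice_mul_gauss hF c hy, ← integral_slice_mul_gauss hF c hy',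
      hF.integral_mul_gauss_eq c hy hy']
  -- Injectivity of the `L²` transform removes `𝓕⁻`; the Gaussian never vanishes, so its common
  -- factor cancels and only the exponentials in `y` remain.
  have h2 : (memLp_freqGauss_mul 0 y g).toLp _ = (memLp_freqGauss_mul 0 y' g').toLp _ := by
    refine (Lp.fourierTransformₗᵢ Plane ℂ).symm.injective (Lp.ext ?_)
    refine (coeFn_fourierInv_toLp (integrable_freqGauss_mul 0 y g) _).trans ?_
    rw [h1]
    exact (coeFn_fourierInv_toLp (integrable_freqGauss_mul 0 y' g') _).symm
  have h3 := (memLp_freqGauss_mul 0 y g).coeFn_toLp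
  rw [h2] at h3
  filter_upwards [h3, (memLp_freqGauss_mul 0 y' g').coeFn_toLp] with ξ h4 h5
  rw [h5] at h4
  have h6 : freqGauss 0 y' ξ = freqGauss 0 y ξ *
      Real.exp (2 * Real.pi * ∑ j, (y' j - y j) * ξ j) := by
    rw [freqGauss, freqGauss, Complex.ofReal_exp, ← Complex.exp_add]
    congr 1
    simp [Fin.sum_univ_two]
    ring
  rw [h6, mul_assoc] at h4
  exact (mul_left_cancel₀ (Complex.exp_ne_zero _) h4).symm

/-! ### The Paley–Wiener theorem -/

theorem lintegral_liminf_le_of_le {h : ℕ → Plane → ℝ≥0∞} (hm : ∀ n, Measurable (h n))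
    {B : ℝ≥0∞} (hB : ∀ n, ∫⁻ ξ, h n ξ ≤ B) : ∫⁻ ξ, liminf (fun n => h n ξ) atTop ≤ B :=
  (lintegral_liminf_le hm).trans (liminf_le_of_le (by isBoundedDefault) fun b hb => by
    obtain ⟨n, hn⟩ := hb.exists
    exact hn.trans (hB n))

theorem volume_coord_eq_zero (j : Fin 2) : volume {ξ : Plane | ξ j = 0} = 0 := by
  have h := Measure.addHaar_submodule (volume : Measure Plane)
    (LinearMap.ker (EuclideanSpace.proj (𝕜 := ℝ) j : Plane →L[ℝ] ℝ).toLinearMap) ?_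
  · convert! h using 2
  · intro h
    have : EuclideanSpace.single j (1 : ℝ) ∈
      (LinearMap.ker (EuclideanSpace.proj (𝕜 := ℝ) j : Plane →L[ℝ] ℝ).toLinearMap) := h ▸ trivial
    simp at this

/-- A function that stays square integrable after multiplication with all decaying exponentials,
with uniform bounds, is square integrable and vanishes off the quadrant. -/
theorem vanish_of_exp_bound {G : Plane → ℂ} (hG : Measurable G) {B : ℝ≥0∞}
    (hBt : B ≠ ∞) (hB : ∀ y : Fin 2 → ℝ, (∀ j, 0 < y j) →
      ∫⁻ ξ, ‖Real.exp (-(2 * Real.pi * ∑ j, y j * ξ j)) * G ξ‖ₑ ^ 2 ≤ B) :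
    MemLp G 2 ∧ ∀ᵐ ξ, ξ ∉ quadrant → G ξ = 0 := by
  have hm : ∀ y : Fin 2 → ℝ, Measurable
      fun ξ : Plane => ‖Real.exp (-(2 * Real.pi * ∑ j, y j * ξ j)) * G ξ‖ₑ ^ 2 := fun y => by
    refine (Measurable.enorm (Measurable.mul (Continuous.measurable ?_) hG)).pow_const _
    fun_prop
  constructor
  · refine ⟨hG.aestronglyMeasurable, ?_⟩
    -- Fatou as `y → 0` along the diagonal: the weights tend to `1`, so `G` inherits the bound.
    have h1 := lintegral_liminf_le_of_le (fun n : ℕ => hm fun _ => 1 / ((n : ℝ) + 1))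
      (fun n => hB _ fun _ => by positivity)
    have h2 : ∀ ξ : Plane, liminf (fun n : ℕ => ‖Real.exp
        (-(2 * Real.pi * ∑ j, 1 / ((n : ℝ) + 1) * ξ j)) * G ξ‖ₑ ^ 2) atTop = ‖G ξ‖ₑ ^ 2 := by
      intro ξ
      refine Tendsto.liminf_eq ?_
      have h3 : Continuous fun s : ℝ =>
          ‖Real.exp (-(2 * Real.pi * ∑ j, s * ξ j)) * G ξ‖ₑ ^ 2 := by
        refine (ENNReal.continuous_pow 2).comp (Continuous.enorm ?_)
        fun_prop
      have h4 := (h3.tendsto 0).comp (tendsto_one_div_add_atTop_nhds_zero_nat (𝕜 := ℝ))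
      simpa [Function.comp_def] using h4
    simp_rw [h2, lintegral_enorm_sq] at h1
    by_contra h
    rw [not_lt, top_le_iff] at h
    rw [h] at h1
    exact hBt (by simpa using h1)
  · have hneg : ∀ j, ∀ᵐ ξ : Plane, ξ j < 0 → G ξ = 0 := by
      intro j
      -- Fatou as `y_j → ∞` with the other coordinate equal to `1`: the weight blows up where `ξ_j <
      -- 0`, so a finite limit inferior forces `G = 0` there.
      have h1 := lintegral_liminf_le_of_le
        (fun n : ℕ => hm (Function.update (fun _ => 1) j ((n : ℝ) + 1)))
        (fun n => hB _ fun k => by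
          by_cases hk : k = j
          · subst hk
            simp
            positivity
          · simp [Function.update_of_ne hk])
      have h2 := ae_lt_top (Measurable.liminf fun n : ℕ =>
        hm (Function.update (fun _ => 1) j ((n : ℝ) + 1))) (ne_top_of_le_ne_top hBt h1)
      filter_upwards [h2] with ξ hξ hj
      by_contra hG0
      refine hξ.ne (Tendsto.liminf_eq ?_)
      have h3 : ∀ n : ℕ, ‖Real.exp (-(2 * Real.pi *
          ∑ k, Function.update (fun _ => (1 : ℝ)) j ((n : ℝ) + 1) k * ξ k)) * G ξ‖ₑ ^ 2 =
          ENNReal.ofReal (Real.exp (-(2 * Real.pi * ∑ k, ξ k)) * ‖G ξ‖ *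
            Real.exp ((n : ℝ) * (2 * Real.pi * (-ξ j)))) ^ 2 := by
        intro n
        rw [← ofReal_norm, norm_mul, Complex.norm_real, Real.norm_of_nonneg (by positivity),
          mul_right_comm (Real.exp _) ‖G ξ‖, ← Real.exp_add]
        congr 4
        fin_cases j <;> simp [Fin.sum_univ_two] <;> ring
      simp_rw [h3]
      have h4 : Tendsto (fun n : ℕ => Real.exp (-(2 * Real.pi * ∑ k, ξ k)) * ‖G ξ‖ *
            Real.exp ((n : ℝ) * (2 * Real.pi * (-ξ j)))) atTop atTop := by
        refine Tendsto.const_mul_atTop (mul_pos (Real.exp_pos _) (norm_pos_iff.2 hG0)) ?_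
        refine Real.tendsto_exp_atTop.comp
          (Tendsto.atTop_mul_const ?_ tendsto_natCast_atTop_atTop)
        have := Real.pi_pos
        nlinarith
      have h5 := (ENNReal.tendsto_ofReal_atTop.comp h4)
      simpa [Function.comp_def] using (ENNReal.continuous_pow 2).tendsto _ |>.comp h5
    have hzero : ∀ j, ∀ᵐ ξ : Plane, ξ j ≠ 0 := fun j => by
      rw [ae_iff]
      simpa using volume_coord_eq_zero j
    filter_upwards [ae_all_iff.2 hneg, ae_all_iff.2 hzero] with ξ h1 h2 h3
    simp only [quadrant, Set.mem_ofPred_eq, not_forall, not_lt] at h3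
    obtain ⟨j, hj⟩ := h3
    exact h1 j (lt_of_le_of_ne hj (h2 j))

theorem continuous_slice {F : (Fin 2 → ℂ) → ℂ} (hF : DifferentiableOn ℂ F upperHalf)
    {y : Fin 2 → ℝ} (hy : ∀ j, 0 < y j) : Continuous (slice F y) :=
  hF.continuousOn.comp_continuous (continuous_point y) fun x => point_mem x hy

theorem exists_point (z : Fin 2 → ℂ) :
    ∃ (x : Plane) (y : Fin 2 → ℝ), z = point x y ∧ ∀ j, y j = (z j).im :=
  ⟨WithLp.toLp 2 fun j => (z j).re, fun j => (z j).im,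
    funext fun j => (Complex.re_add_im (z j)).symm, fun _ => rfl⟩

/-- The Paley-Wiener theorem for `H²(ℍ²)`. -/
theorem HardyClass.exists_spectral {F : (Fin 2 → ℂ) → ℂ} (hF : HardyClass F) :
    ∃ f ∈ spectral, Set.EqOn F (ext f) upperHalf := by
  have h1 : ∀ j : Fin 2, (0 : ℝ) < (fun _ => 1 : Fin 2 → ℝ) j := fun _ => one_pos
  set g : L2 := 𝓕 ((hF.memLp_slice h1).toLp _) with hg
  -- Undoing the damping at height `(1, 1)` produces the candidate for the transform of the boundary
  -- function.
  set G : Plane → ℂ := fun ξ => Real.exp (2 * Real.pi * ∑ j, ξ j) * g ξ with hGdef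
  have hGm : Measurable G := by
    refine Measurable.mul (Continuous.measurable ?_) (Lp.stronglyMeasurable g).measurable
    fun_prop
  have hslice : ∀ (y : Fin 2 → ℝ) (hy : ∀ j, 0 < y j),
      ∀ᵐ ξ : Plane, (𝓕 ((hF.memLp_slice hy).toLp _) : L2) ξ =
        Real.exp (-(2 * Real.pi * ∑ j, y j * ξ j)) * G ξ := by
    intro y hy
    filter_upwards [hF.exp_mul_fourier_slice hy h1] with ξ hξ
    rw [hξ, hGdef, ← mul_assoc, ← Complex.ofReal_mul, ← Real.exp_add]
    congr 3
    simp [Fin.sum_univ_two]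
    ring
  obtain ⟨M, hM⟩ := hF.2
  have hB : ∀ y : Fin 2 → ℝ, (∀ j, 0 < y j) →
      ∫⁻ ξ, ‖Real.exp (-(2 * Real.pi * ∑ j, y j * ξ j)) * G ξ‖ₑ ^ 2 ≤ (M : ℝ≥0∞) ^ 2 := by
    intro y hy
    rw [lintegral_enorm_sq, ← eLpNorm_congr_ae (hslice y hy), ← Lp.enorm_def]
    have h2 : ‖(𝓕 ((hF.memLp_slice hy).toLp _) : L2)‖ₑ = ‖(hF.memLp_slice hy).toLp _‖ₑ :=
      (Lp.fourierTransformₗᵢ Plane ℂ).enorm_map _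
    rw [h2, Lp.enorm_def, eLpNorm_congr_ae (MemLp.coeFn_toLp _)]
    exact pow_le_pow_left' (hM y hy) 2
  obtain ⟨hG2, hG0⟩ := vanish_of_exp_bound hGm (by simp) hB
  set f : L2 := 𝓕⁻ (hG2.toLp G) with hf
  have hFf : (𝓕 f : L2) = hG2.toLp G := (Lp.fourierTransformₗᵢ Plane ℂ).apply_symm_apply _
  refine ⟨f, ?_, fun z hz => ?_⟩
  · rw [mem_spectral, hFf]
    filter_upwards [hG2.coeFn_toLp, hG0] with ξ h2 h3
    rwa [h2]
  · obtain ⟨x, y, rfl, hy⟩ := exists_point z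
    have hy0 : ∀ j, 0 < y j := fun j => by
      rw [hy]
      exact hz j
    have h4 : slice F y =ᵐ[volume] slice (ext f) y := by
      refine EventuallyEq.trans ?_ (slice_ext_ae hy0 f).symm
      have h5 : (memLp_kernel_mul (fun j => (point_zero_mem hy0 j).le) (𝓕 f)).toLp _ =
          (𝓕 ((hF.memLp_slice hy0).toLp _) : L2) := by
        refine Lp.ext ((MemLp.coeFn_toLp _).trans ?_)
        rw [hFf]
        filter_upwards [hG2.coeFn_toLp, hG0, hslice y hy0] with ξ h2 h3 h6
        rw [h6, h2]
        by_cases hξ : ξ ∈ quadrant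
        · rw [kernel_of_mem _ hξ, Complex.ofReal_exp]
          congr 2
          simp [point, Fin.sum_univ_two]
          ring_nf
          simp only [Complex.I_sq]
          ring
        · rw [h3 hξ, mul_zero, mul_zero]
      rw [h5]
      have h7 : (𝓕⁻ (𝓕 ((hF.memLp_slice hy0).toLp _) : L2) : L2) = (hF.memLp_slice hy0).toLp _ :=
        (Lp.fourierTransformₗᵢ Plane ℂ).symm_apply_apply _
      rw [h7]
      exact (MemLp.coeFn_toLp _).symm
    -- Both slices are continuous, so equality almost everywhere is equality at every point.
    exact congrFun ((Continuous.ae_eq_iff_eq volume (continuous_slice hF.1 hy0)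
      (continuous_slice (differentiableOn_ext f) hy0)).1 h4) x

/-! ### Boundary values and the identification of `H²` -/

theorem coeFn_mulL2 {σ : Plane → ℂ} (hσ : MemLp σ ∞ volume) (f : L2) :
    mulL2 σ f =ᵐ[volume] fun x => σ x * f x := by
  rw [mulL2, dif_pos hσ]
  change (ContinuousLinearMap.holder 2 (ContinuousLinearMap.mul ℂ ℂ) (hσ.toLp σ) f :
    Plane → ℂ) =ᵐ[volume] _
  filter_upwards [ContinuousLinearMap.coeFn_holder (r := 2) (ContinuousLinearMap.mul ℂ ℂ)
    (hσ.toLp σ) f, hσ.coeFn_toLp] with x hx hx'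
  rw [hx, hx']
  rfl

theorem norm_mulL2_le {σ : Plane → ℂ} {c : ℝ} (hc : 0 ≤ c) (hσc : ∀ᵐ x, ‖σ x‖ ≤ c) :
    ‖mulL2 σ‖ ≤ c := by
  by_cases hσ : MemLp σ ∞ volume
  · refine ContinuousLinearMap.opNorm_le_bound _ hc fun f => ?_
    refine Lp.norm_le_mul_norm_of_ae_le_mul ?_
    filter_upwards [coeFn_mulL2 hσ f, hσc] with x hx hx'
    rw [hx, norm_mul]
    exact mul_le_mul_of_nonneg_right hx' (norm_nonneg _)
  · rw [mulL2, dif_neg hσ, norm_zero]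
    exact hc

/-- The subspace is the kernel of a continuous map: the Fourier transform followed by multiplication
by the indicator of the complement of the quadrant. -/
theorem isClosed_spectral : IsClosed (spectral : Set L2) := by
  have hσ : MemLp (quadrantᶜ.indicator fun _ : Plane => (1 : ℂ)) ∞ volume :=
    (memLp_top_const 1).indicator measurableSet_quadrant.compl
  have h : (spectral : Set L2) =
      (fun f : L2 => mulL2 (quadrantᶜ.indicator fun _ => (1 : ℂ)) (𝓕 f)) ⁻¹' {0} := by
    ext f
    rw [SetLike.mem_coe, mem_spectral, Set.mem_preimage, Set.mem_singleton_iff,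
      Lp.eq_zero_iff_ae_eq_zero]
    refine eventually_congr ?_
    filter_upwards [coeFn_mulL2 hσ (𝓕 f)] with ξ hξ
    rw [hξ]
    by_cases hq : ξ ∈ quadrant <;> simp [hq]
  rw [h]
  exact isClosed_singleton.preimage ((mulL2 _).continuous.comp
    (Lp.fourierTransformₗᵢ Plane ℂ).continuous)

theorem ae_of_ae_ball {P : Plane → Prop}
    (h : ∀ R : ℝ, ∀ᵐ x ∂(volume.restrict (Metric.closedBall (0 : Plane) R)), P x) :
    ∀ᵐ x, P x := by
  have h2 : ∀ n : ℕ, ∀ᵐ x : Plane, x ∈ Metric.closedBall (0 : Plane) n → P x := fun n =>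
    (ae_restrict_iff' measurableSet_closedBall).1 (h n)
  filter_upwards [ae_all_iff.2 h2] with x hx
  obtain ⟨n, hn⟩ := exists_nat_ge ‖x‖
  exact hx n (by simpa using hn)

/-- The slices of `F` converge to `b` almost everywhere along subsequences. -/
def SlicesTendsto (F : (Fin 2 → ℂ) → ℂ) (b : Plane → ℂ) : Prop :=
  ∀ (R : ℝ) (y : ℕ → Fin 2 → ℝ), (∀ n j, 0 < y n j) → Tendsto y atTop (𝓝 0) →
    ∃ ns : ℕ → ℕ, StrictMono ns ∧
      ∀ᵐ x ∂(volume.restrict (Metric.closedBall (0 : Plane) R)),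
        Tendsto (fun i => slice F (y (ns i)) x) atTop (𝓝 (b x))

theorem IsBoundaryFunction.slicesTendsto {F : (Fin 2 → ℂ) → ℂ} {b : Plane → ℂ}
    (hb : IsBoundaryFunction F b) (hF : DifferentiableOn ℂ F upperHalf) : SlicesTendsto F b := by
  intro R y hy0 hy
  have hy' : Tendsto y atTop (𝓝[{y | ∀ j, 0 < y j}] 0) :=
    tendsto_nhdsWithin_iff.2 ⟨hy, Eventually.of_forall hy0⟩
  exact (tendstoInMeasure_of_tendsto_eLpNorm (by norm_num)
    (fun n => HardyClass.aestronglyMeasurable_slice hF (hy0 n) _) hb.1.restrict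
    ((hb.2 R).comp hy')).exists_seq_tendsto_ae

/-- A sequence in the quadrant that tends to zero. -/
theorem exists_seq_quadrant : ∃ y : ℕ → Fin 2 → ℝ, (∀ n j, 0 < y n j) ∧ Tendsto y atTop (𝓝 0) :=
  ⟨fun n _ => 1 / ((n : ℝ) + 1), fun n _ => by positivity,
    tendsto_pi_nhds.2 fun _ => tendsto_one_div_add_atTop_nhds_zero_nat⟩

/-- Successive subsequences give one along which all three slices converge almost everywhere on a
ball, and a closed relation survives the limit. Uniqueness, bounds and products of boundary
functions are all instances. -/
theorem SlicesTendsto.ae_of_closed {F G H : (Fin 2 → ℂ) → ℂ} {b c d : Plane → ℂ}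
    (hF : SlicesTendsto F b) (hG : SlicesTendsto G c) (hH : SlicesTendsto H d)
    {K : Set (ℂ × ℂ × ℂ)} (hK : IsClosed K) (h : ∀ z ∈ upperHalf, (F z, G z, H z) ∈ K) :
    ∀ᵐ x, (b x, c x, d x) ∈ K := by
  obtain ⟨y, hy0, hy⟩ := exists_seq_quadrant
  refine ae_of_ae_ball fun R => ?_
  obtain ⟨n₁, h₁, hn₁⟩ := hF R y hy0 hy
  obtain ⟨n₂, h₂, hn₂⟩ := hG R (y ∘ n₁) (fun n => hy0 _) (hy.comp h₁.tendsto_atTop)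
  obtain ⟨n₃, h₃, hn₃⟩ := hH R (y ∘ n₁ ∘ n₂) (fun n => hy0 _)
    (hy.comp (h₁.tendsto_atTop.comp h₂.tendsto_atTop))
  filter_upwards [hn₁, hn₂, hn₃] with x hx₁ hx₂ hx₃
  refine hK.mem_of_tendsto ((hx₁.comp (h₂.tendsto_atTop.comp h₃.tendsto_atTop)).prodMk_nhds
    ((hx₂.comp h₃.tendsto_atTop).prodMk_nhds hx₃)) (Eventually.of_forall fun i => ?_)
  exact h _ (point_mem x (hy0 _))

theorem SlicesTendsto.unique {F G : (Fin 2 → ℂ) → ℂ} {b c : Plane → ℂ} (hF : SlicesTendsto F b)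
    (hG : SlicesTendsto G c) (h : Set.EqOn F G upperHalf) : b =ᵐ[volume] c :=
  hF.ae_of_closed hG hG (K := {p | p.1 = p.2.1})
    (isClosed_eq continuous_fst (continuous_fst.comp continuous_snd)) h

theorem SlicesTendsto.norm_le {F : (Fin 2 → ℂ) → ℂ} {b : Plane → ℂ} (hF : SlicesTendsto F b)
    {C : ℝ} (h : ∀ z ∈ upperHalf, ‖F z‖ ≤ C) : ∀ᵐ x, ‖b x‖ ≤ C :=
  hF.ae_of_closed hF hF (K := {p | ‖p.1‖ ≤ C})
    (isClosed_le (continuous_norm.comp continuous_fst) continuous_const) h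

theorem slicesTendsto_ext {f : L2} (hf : f ∈ spectral) : SlicesTendsto (ext f) f :=
  (isHardyExtension_ext hf).2.slicesTendsto (differentiableOn_ext f)

theorem ext_injOn {f g : L2} (hf : f ∈ spectral) (hg : g ∈ spectral)
    (h : Set.EqOn (ext f) (ext g) upperHalf) : f = g :=
  Lp.ext ((slicesTendsto_ext hf).unique (slicesTendsto_ext hg) h)

/-- Paley–Wiener gives `F = ext g` for some `g` in `spectral`, and uniqueness of boundary functions
gives `g = f`. -/
theorem IsHardyExtension.mem_spectral {F : (Fin 2 → ℂ) → ℂ} {f : L2} (h : IsHardyExtension F f) :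
    f ∈ spectral ∧ Set.EqOn F (ext f) upperHalf := by
  obtain ⟨g, hg, hFg⟩ := h.1.exists_spectral
  have : f = g := Lp.ext ((h.2.slicesTendsto h.1.1).unique (slicesTendsto_ext hg) hFg)
  rw [this]
  exact ⟨hg, hFg⟩

/-- The space of boundary functions already equals `spectral`, which is closed, so the closure in
the definition of `H2` adds nothing. -/
theorem H2_eq_spectral : H2 = spectral := by
  have h : hardyBoundary = spectral := by
    ext f
    constructor
    · rintro ⟨F, hF⟩
      exact hF.mem_spectral.1
    · exact fun hf => ⟨_, isHardyExtension_ext hf⟩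
  rw [H2, h]
  exact isClosed_spectral.submodule_topologicalClosure_eq

theorem coe_mem_spectral (f : H2) : (f : L2) ∈ spectral := H2_eq_spectral ▸ f.2

theorem slice_congr {F G : (Fin 2 → ℂ) → ℂ} (h : Set.EqOn F G upperHalf) {y : Fin 2 → ℝ}
    (hy : ∀ j, 0 < y j) : slice F y = slice G y :=
  funext fun x => h (point_mem x hy)

theorem IsHardyExtension.congr {F G : (Fin 2 → ℂ) → ℂ} {f : L2} (hF : IsHardyExtension F f)
    (h : Set.EqOn F G upperHalf) : IsHardyExtension G f := by
  obtain ⟨⟨hd, M, hM⟩, hm, hb⟩ := hF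
  refine ⟨⟨hd.congr fun z hz => (h hz).symm, M, fun y hy => ?_⟩, hm, fun R => ?_⟩
  · rw [← slice_congr h hy]
    exact hM y hy
  · refine (hb R).congr' ?_
    filter_upwards [self_mem_nhdsWithin] with y hy
    rw [slice_congr h hy]

/-! ### Bounded holomorphic multipliers and their boundary functions -/

theorem HardyClass.mul_bounded {s F : (Fin 2 → ℂ) → ℂ} (hs : DifferentiableOn ℂ s upperHalf)
    {C : ℝ} (hC : ∀ z ∈ upperHalf, ‖s z‖ ≤ C) (hF : HardyClass F) :
    HardyClass fun z => s z * F z := by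
  obtain ⟨hd, M, hM⟩ := hF
  refine ⟨hs.mul hd, C.toNNReal * M, fun y hy => ?_⟩
  calc eLpNorm (slice (fun z => s z * F z) y) 2 volume
      ≤ ENNReal.ofReal C * eLpNorm (slice F y) 2 volume :=
        eLpNorm_le_mul_eLpNorm_of_ae_le_mul (Eventually.of_forall fun x => by
          simp only [slice, norm_mul]
          exact mul_le_mul_of_nonneg_right (hC _ (point_mem x hy)) (norm_nonneg _)) 2
    _ ≤ _ := by
        rw [ENNReal.coe_mul]
        exact mul_le_mul_right (hM y hy) _

/-- Multiplication by a bounded holomorphic function, on the boundary and in the interior. -/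
theorem exists_spectral_mul {s : (Fin 2 → ℂ) → ℂ} {σ : Plane → ℂ}
    (hs : DifferentiableOn ℂ s upperHalf) {C : ℝ} (hC : ∀ z ∈ upperHalf, ‖s z‖ ≤ C)
    (hσ : SlicesTendsto s σ) {f : L2} (hf : f ∈ spectral) :
    ∃ g ∈ spectral, Set.EqOn (ext g) (fun z => s z * ext f z) upperHalf ∧
      g =ᵐ[volume] fun x => σ x * f x := by
  obtain ⟨g, hg, hgs⟩ := ((hardyClass_ext f).mul_bounded hs hC).exists_spectral
  refine ⟨g, hg, hgs.symm, ?_⟩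
  exact (slicesTendsto_ext hg).ae_of_closed hσ (slicesTendsto_ext hf)
    (K := {p | p.1 = p.2.1 * p.2.2}) (isClosed_eq (by fun_prop) (by fun_prop))
    fun z hz => (hgs hz).symm

/-- A nowhere vanishing function of the Hardy class. -/
def cayley (z : Fin 2 → ℂ) : ℂ := ∏ j, (z j + Complex.I)⁻¹

theorem add_I_ne_zero {z : ℂ} (hz : 0 ≤ z.im) : z + Complex.I ≠ 0 := fun h => by
  have := congrArg Complex.im h
  simp at this
  linarith

theorem hardyClass_cayley : HardyClass cayley := by
  have h0 : ∀ x : ℝ, (x : ℂ) + Complex.I ≠ 0 := fun x => add_I_ne_zero (by simp)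
  -- Raising the height moves `x + iy` away from the pole `-i`, so every slice is dominated by the
  -- one at height zero.
  have hn : ∀ x y : ℝ, 0 ≤ y → ‖((x : ℂ) + y * Complex.I + Complex.I)⁻¹‖ ≤
      ‖((x : ℂ) + Complex.I)⁻¹‖ := by
    intro x y hy
    rw [norm_inv, norm_inv]
    refine inv_anti₀ (norm_pos_iff.2 (h0 x)) ?_
    rw [← sq_le_sq₀ (norm_nonneg _) (norm_nonneg _), ← Complex.normSq_eq_norm_sq,
      ← Complex.normSq_eq_norm_sq, Complex.normSq_apply, Complex.normSq_apply]
    simp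
    nlinarith
  have hL : MemLp (fun x : Plane => ∏ j, ((x j : ℂ) + Complex.I)⁻¹) 2 := by
    have hc : Continuous fun x : Plane => ∏ j, ((x j : ℂ) + Complex.I)⁻¹ :=
      continuous_finsetProd _ fun j _ => Continuous.inv₀ (by fun_prop) fun x => h0 _
    rw [memLp_two_iff_integrable_sq_norm hc.aestronglyMeasurable]
    have h1 := integrable_prod_plane (f := fun _ t => (((1 + t ^ 2)⁻¹ : ℝ) : ℂ))
      fun _ => integrable_inv_one_add_sq.ofReal
    refine h1.norm.congr (Eventually.of_forall fun x => ?_)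
    simp only [norm_prod, ← Finset.prod_pow]
    refine Finset.prod_congr rfl fun j _ => ?_
    rw [Complex.norm_real, Real.norm_of_nonneg (by positivity), norm_inv, inv_pow,
      ← Complex.normSq_eq_norm_sq, Complex.normSq_apply]
    simp
    ring
  refine ⟨fun z hz => ?_, (eLpNorm (fun x : Plane => ∏ j, ((x j : ℂ) + Complex.I)⁻¹) 2
    volume).toNNReal, fun y hy => ?_⟩
  · refine DifferentiableAt.differentiableWithinAt ?_
    have h2 : ∀ j, DifferentiableAt ℂ (fun z : Fin 2 → ℂ => (z j + Complex.I)⁻¹) z := fun j =>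
      DifferentiableAt.fun_inv (by fun_prop) (add_I_ne_zero (hz j).le)
    unfold cayley
    simp only [Fin.prod_univ_two]
    exact (h2 0).mul (h2 1)
  · rw [ENNReal.coe_toNNReal hL.2.ne]
    refine eLpNorm_mono fun x => ?_
    simp only [slice, cayley, norm_prod, point]
    exact Finset.prod_le_prod (fun j _ => norm_nonneg _) fun j _ => hn _ _ (hy j).le

theorem slicesTendsto_cayley : SlicesTendsto cayley fun x => ∏ j, ((x j : ℂ) + Complex.I)⁻¹ := by
  intro R y hy0 hy
  refine ⟨id, strictMono_id, Eventually.of_forall fun x => ?_⟩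
  simp only [slice, cayley, point]
  refine tendsto_finsetProd _ fun j _ => Tendsto.inv₀ ?_ (add_I_ne_zero (by simp))
  have h1 : Tendsto (fun n => ((y n j : ℝ) : ℂ)) atTop (𝓝 ((0 : ℝ) : ℂ)) :=
    (Complex.continuous_ofReal.tendsto 0).comp ((tendsto_pi_nhds.1 hy) j)
  simpa using ((h1.mul_const Complex.I).const_add (x j : ℂ)).add_const Complex.I

/-- Bounded holomorphic functions on `ℍ²` have boundary functions. -/
theorem exists_isBoundaryFunction {s : (Fin 2 → ℂ) → ℂ} (hs : DifferentiableOn ℂ s upperHalf)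
    {C : ℝ} (hC : ∀ z ∈ upperHalf, ‖s z‖ ≤ C) :
    ∃ b : Plane → ℂ, IsBoundaryFunction s b := by
  -- A bounded `s` need not be in the Hardy class, but `s · cayley` is. Its boundary function `g`
  -- divided by `k₀`, the boundary function of `cayley`, is the candidate for `s`; `k₀⁻¹` is bounded
  -- on each ball.
  set k₀ : Plane → ℂ := fun x => ∏ j, ((x j : ℂ) + Complex.I)⁻¹ with hk₀
  have h0 : ∀ x : Plane, k₀ x ≠ 0 := fun x =>
    Finset.prod_ne_zero_iff.2 fun j _ => inv_ne_zero (add_I_ne_zero (by simp))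
  obtain ⟨f, hf, hfk⟩ := hardyClass_cayley.exists_spectral
  have hfk₀ : f =ᵐ[volume] k₀ := (slicesTendsto_ext hf).unique slicesTendsto_cayley hfk.symm
  obtain ⟨g, hg, hgs⟩ := (hardyClass_cayley.mul_bounded hs hC).exists_spectral
  have hinv : Continuous fun x => (k₀ x)⁻¹ := by
    refine Continuous.inv₀ ?_ h0
    exact continuous_finsetProd _ fun j _ => Continuous.inv₀ (by fun_prop)
      fun x => add_I_ne_zero (by simp)
  refine ⟨fun x => (k₀ x)⁻¹ * g x,
    hinv.aestronglyMeasurable.mul (Lp.aestronglyMeasurable g), fun R => ?_⟩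
  obtain ⟨D, hD⟩ := (isCompact_closedBall (0 : Plane) R).exists_bound_of_continuousOn
    hinv.continuousOn
  have hlim := ENNReal.Tendsto.const_mul (a := ENNReal.ofReal D)
    ((tendsto_slice_ext hg).add (ENNReal.Tendsto.const_mul (a := ENNReal.ofReal C)
      (tendsto_slice_ext hf) (Or.inr ENNReal.ofReal_ne_top))) (Or.inr ENNReal.ofReal_ne_top)
  simp only [mul_zero, add_zero] at hlim
  refine tendsto_of_tendsto_of_tendsto_of_le_of_le' tendsto_const_nhds hlim
    (Eventually.of_forall fun _ => zero_le) ?_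
  filter_upwards [self_mem_nhdsWithin] with y hy
  have hcs := continuous_slice hs hy
  have hm1 : AEStronglyMeasurable (fun x => slice (ext g) y x - g x) volume :=
    (continuous_slice (differentiableOn_ext g) hy).aestronglyMeasurable.sub
      (Lp.aestronglyMeasurable g)
  have hm2 : AEStronglyMeasurable (fun x => slice s y x * (slice (ext f) y x - f x)) volume :=
    hcs.aestronglyMeasurable.mul
      ((continuous_slice (differentiableOn_ext f) hy).aestronglyMeasurable.sub
      (Lp.aestronglyMeasurable f))
  calc eLpNorm (fun x => slice s y x - (k₀ x)⁻¹ * g x) 2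
        (volume.restrict (Metric.closedBall 0 R))
      ≤ ENNReal.ofReal D * eLpNorm ((fun x => slice (ext g) y x - g x) -
          fun x => slice s y x * (slice (ext f) y x - f x)) 2
        (volume.restrict (Metric.closedBall 0 R)) := by
        refine eLpNorm_le_mul_eLpNorm_of_ae_le_mul ?_ 2
        filter_upwards [ae_restrict_mem measurableSet_closedBall, ae_restrict_of_ae hfk₀]
          with x hx hx'
        have e1 : slice (ext g) y x = slice s y x * slice (ext f) y x := by
          rw [← slice_congr hgs hy, ← slice_congr hfk hy]
          rfl
        -- With `f_y` the slice of `cayley`, this reads `s - k₀⁻¹ g = k₀⁻¹ ((s f_y - g) - s (f_y -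
        -- k₀))`; both differences tend to zero in `L²`.
        have e2 : slice s y x - (k₀ x)⁻¹ * g x = (k₀ x)⁻¹ *
            (((fun x => slice (ext g) y x - g x) -
              fun x => slice s y x * (slice (ext f) y x - f x)) x) := by
          simp only [Pi.sub_apply, e1, hx']
          have := h0 x
          field_simp
          ring
        rw [e2, norm_mul]
        exact mul_le_mul_of_nonneg_right (hD x hx) (norm_nonneg _)
    _ ≤ ENNReal.ofReal D * eLpNorm ((fun x => slice (ext g) y x - g x) -
          fun x => slice s y x * (slice (ext f) y x - f x)) 2 volume :=
        mul_le_mul_right (eLpNorm_mono_measure _ Measure.restrict_le_self) _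
    _ ≤ _ := by
        refine mul_le_mul_right ((eLpNorm_sub_le hm1 hm2 (by norm_num)).trans
          (add_le_add_right ?_ _)) _
        refine eLpNorm_le_mul_eLpNorm_of_ae_le_mul (Eventually.of_forall fun x => ?_) 2
        rw [norm_mul]
        exact mul_le_mul_of_nonneg_right (hC _ (point_mem x hy)) (norm_nonneg _)

/-! ### Toeplitz operators and Fourier multipliers on `H²` -/

theorem coe_orthogonalProjectionOnto_of_mem {v : L2} (hv : v ∈ spectral) :
    ((H2.orthogonalProjectionOnto v : H2) : L2) = v := by
  have hv' : v ∈ H2 := H2_eq_spectral.symm ▸ hv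
  rw [← Submodule.starProjection_apply, Submodule.starProjection_eq_self_iff.2 hv']

/-- An analytic symbol keeps `σ f` in `H²`, so the projection does nothing and the operator is
multiplication inside `ℍ²`. This allows the series to be evaluated point by point. -/
theorem ext_toeplitz {σ : Plane → ℂ} (hσ : MemLp σ ∞ volume) {s : (Fin 2 → ℂ) → ℂ}
    (hs : DifferentiableOn ℂ s upperHalf) {C : ℝ} (hC : ∀ z ∈ upperHalf, ‖s z‖ ≤ C)
    (hsσ : SlicesTendsto s σ) (f : H2) :
    Set.EqOn (ext (toeplitz σ f)) (fun z => s z * ext f z) upperHalf := by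
  obtain ⟨g, hg, hgs, hgσ⟩ := exists_spectral_mul hs hC hsσ (coe_mem_spectral f)
  have h1 : mulL2 σ f = g := Lp.ext ((coeFn_mulL2 hσ f).trans hgσ.symm)
  have h2 : (toeplitz σ f : L2) = g := by
    change ((H2.orthogonalProjectionOnto (mulL2 σ f) : H2) : L2) = g
    rw [h1, coe_orthogonalProjectionOnto_of_mem hg]
  rw [h2]
  exact hgs

theorem norm_compress_le (T : L2 →L[ℂ] L2) :
    ‖H2.orthogonalProjectionOnto ∘L T ∘L H2.subtypeL‖ ≤ ‖T‖ := by
  refine ContinuousLinearMap.opNorm_le_bound _ (norm_nonneg _) fun f => ?_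
  change ‖H2.orthogonalProjectionOnto (T f)‖ ≤ ‖T‖ * ‖(f : L2)‖
  exact (H2.norm_orthogonalProjectionOnto_apply_le (T f)).trans (T.le_opNorm (f : L2))

theorem norm_toeplitz_le {σ : Plane → ℂ} {c : ℝ} (hc : 0 ≤ c) (hσ : ∀ᵐ x, ‖σ x‖ ≤ c) :
    ‖toeplitz σ‖ ≤ c :=
  (norm_compress_le _).trans (norm_mulL2_le hc hσ)

theorem quadrantSymbol_of_mem (ϑ : (Fin 2 → ℝ) → ℂ) {ξ : Plane} (hξ : ξ ∈ quadrant) :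
    quadrantSymbol ϑ ξ = ϑ fun j => 2 * Real.pi * ξ j :=
  Set.indicator_of_mem (s := quadrant) hξ _

theorem quadrantSymbol_of_notMem (ϑ : (Fin 2 → ℝ) → ℂ) {ξ : Plane} (hξ : ξ ∉ quadrant) :
    quadrantSymbol ϑ ξ = 0 :=
  Set.indicator_of_notMem (s := quadrant) hξ _

theorem fourier_fourierMultiplierL2 (ϑ : (Fin 2 → ℝ) → ℂ) (f : L2) :
    (𝓕 (fourierMultiplierL2 ϑ f) : L2) = mulL2 (quadrantSymbol ϑ) (𝓕 f) :=
  (Lp.fourierTransformₗᵢ Plane ℂ).apply_symm_apply _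

theorem fourierMultiplierL2_mem {ϑ : (Fin 2 → ℝ) → ℂ} (hϑ : MemLp (quadrantSymbol ϑ) ∞ volume)
    (f : L2) : fourierMultiplierL2 ϑ f ∈ spectral := by
  rw [mem_spectral, fourier_fourierMultiplierL2]
  filter_upwards [coeFn_mulL2 hϑ (𝓕 f)] with ξ hξ hq
  rw [hξ, quadrantSymbol_of_notMem _ hq, zero_mul]

theorem fourier_fourierMultiplier {ϑ : (Fin 2 → ℝ) → ℂ} (hϑ : MemLp (quadrantSymbol ϑ) ∞ volume)
    (f : H2) : (𝓕 (fourierMultiplier ϑ f : L2) : L2) =ᵐ[volume]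
      fun ξ => quadrantSymbol ϑ ξ * (𝓕 (f : L2) : L2) ξ := by
  have h : (fourierMultiplier ϑ f : L2) = fourierMultiplierL2 ϑ f :=
    coe_orthogonalProjectionOnto_of_mem (fourierMultiplierL2_mem hϑ f)
  rw [h, fourier_fourierMultiplierL2]
  exact coeFn_mulL2 hϑ _

theorem norm_fourierMultiplier_le {ϑ : (Fin 2 → ℝ) → ℂ} {c : ℝ} (hc : 0 ≤ c)
    (hϑ : ∀ ξ, ‖quadrantSymbol ϑ ξ‖ ≤ c) : ‖fourierMultiplier ϑ‖ ≤ c := by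
  refine (norm_compress_le _).trans (ContinuousLinearMap.opNorm_le_bound _ hc fun f => ?_)
  have h1 : ‖fourierMultiplierL2 ϑ f‖ = ‖mulL2 (quadrantSymbol ϑ) (𝓕 f)‖ :=
    (Lp.fourierTransformₗᵢ Plane ℂ).symm.norm_map _
  rw [h1, ← Lp.norm_fourier_eq f]
  exact ((mulL2 _).le_opNorm _).trans (mul_le_mul_of_nonneg_right
    (norm_mulL2_le hc (Eventually.of_forall hϑ)) (norm_nonneg _))

/-- A single term of the exponential series is at most its sum: `(αt)ⁿ/n! ≤ e^{αt}`. -/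
theorem norm_quadrantSymbol_theta_le {α : ℝ} (hα : 0 < α) (j : Fin 2) (n : ℕ) (ξ : Plane) :
    ‖quadrantSymbol (theta α j n) ξ‖ ≤ (α ^ n)⁻¹ := by
  by_cases hξ : ξ ∈ quadrant
  · rw [quadrantSymbol_of_mem _ hξ, theta]
    have ht : 0 < 2 * Real.pi * ξ j := mul_pos (by positivity) (hξ j)
    set t : ℝ := 2 * Real.pi * ξ j
    have h1 := Real.pow_div_factorial_le_exp (α * t) (by positivity) n
    have hexp : ‖Complex.exp (-((α : ℂ) * (t : ℂ)))‖ = Real.exp (-(α * t)) := by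
      rw [Complex.norm_exp]
      norm_num
    rw [norm_div, norm_mul, norm_pow, norm_mul, norm_neg, Complex.norm_I, one_mul, hexp,
      Complex.norm_real, Complex.norm_natCast, Real.norm_of_nonneg ht.le]
    clear_value t
    calc t ^ n * Real.exp (-(α * t)) / n.factorial
        = (α ^ n)⁻¹ * ((α * t) ^ n / n.factorial * Real.exp (-(α * t))) := by
          rw [mul_pow]
          field_simp
      _ ≤ (α ^ n)⁻¹ * (Real.exp (α * t) * Real.exp (-(α * t))) := by gcongr
      _ = (α ^ n)⁻¹ := by rw [← Real.exp_add]; simp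
  · rw [quadrantSymbol_of_notMem _ hξ, norm_zero]
    positivity

/-! ### The exponential expansion at a fixed point -/

/-- The symbols `τⁿ ϑ_n` sum to an exponential. -/
theorem hasSum_pow_mul_theta (α : ℝ) (j : Fin 2) (τ : ℂ) {ξ : Plane} (hξ : ξ ∈ quadrant) :
    (Summable fun n : ℕ => ‖τ ^ n * quadrantSymbol (theta α j n) ξ‖) ∧
    HasSum (fun n : ℕ => τ ^ n * quadrantSymbol (theta α j n) ξ)
      (Complex.exp (2 * Real.pi * Complex.I * ((Complex.I * α - τ) * ξ j))) := by
  set t : ℂ := ((2 * Real.pi * ξ j : ℝ) : ℂ) with ht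
  have h1 : ∀ n : ℕ, τ ^ n * quadrantSymbol (theta α j n) ξ =
      (τ * (-Complex.I * t)) ^ n / n.factorial * Complex.exp (-(α * t)) := by
    intro n
    rw [quadrantSymbol_of_mem _ hξ, theta, mul_pow]
    ring
  simp_rw [h1]
  constructor
  · simp_rw [norm_mul]
    exact (NormedSpace.norm_expSeries_div_summable (𝔸 := ℂ) _).mul_right _
  · have h2 := (NormedSpace.expSeries_div_hasSum_exp (𝔸 := ℂ) (τ * (-Complex.I * t))).mul_right
      (Complex.exp (-(α * t)))
    rw [← Complex.exp_eq_exp_ℂ, ← Complex.exp_add] at h2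
    convert! h2 using 2
    rw [ht]
    push_cast
    ring_nf
    simp only [Complex.I_sq]
    ring

/-- Here the `τ j` are numbers, the values of the symbols at one point. The `(n, m)` integrand is at
most `(δ/α)^(n+m) |kernel z · f̂|`, so sum and integral may be exchanged. -/
theorem hasSum_ext {α δ : ℝ} (hα : 0 < α) (hδ0 : 0 ≤ δ) (hδ : δ < α) (f : H2) {z w : Fin 2 → ℂ}
    (hz : z ∈ upperHalf) {τ : Fin 2 → ℂ} (hτ : ∀ j, ‖τ j‖ ≤ δ)
    (hw : ∀ j, w j = z j + (Complex.I * α - τ j)) :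
    HasSum (fun k : ℕ × ℕ => τ 0 ^ k.1 * (τ 1 ^ k.2 *
      ext (fourierMultiplier (theta α 0 k.1) (fourierMultiplier (theta α 1 k.2) f)) z))
      (ext f w) := by
  set g : L2 := 𝓕 (f : L2) with hg
  let a : ℕ → Plane → ℂ := fun n ξ => τ 0 ^ n * quadrantSymbol (theta α 0 n) ξ
  let b : ℕ → Plane → ℂ := fun n ξ => τ 1 ^ n * quadrantSymbol (theta α 1 n) ξ
  have hq0 : 0 ≤ δ / α := by positivity
  have hq1 : δ / α < 1 := (div_lt_one hα).2 hδ
  have hbound : ∀ (j : Fin 2) (n : ℕ) (ξ : Plane),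
      ‖τ j ^ n * quadrantSymbol (theta α j n) ξ‖ ≤ (δ / α) ^ n := fun j n ξ => by
    rw [norm_mul, norm_pow, div_pow, div_eq_mul_inv]
    exact mul_le_mul (pow_le_pow_left₀ (norm_nonneg _) (hτ j) n)
      (norm_quadrantSymbol_theta_le hα j n ξ) (norm_nonneg _) (by positivity)
  let H : ℕ × ℕ → Plane → ℂ := fun k ξ => (a k.1 ξ * b k.2 ξ) * (kernel z ξ * g ξ)
  have hHb : ∀ k ξ, ‖H k ξ‖ ≤ ((δ / α) ^ k.1 * (δ / α) ^ k.2) * ‖kernel z ξ * g ξ‖ := by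
    intro k ξ
    rw [norm_mul, norm_mul]
    exact mul_le_mul_of_nonneg_right (mul_le_mul (hbound 0 _ _) (hbound 1 _ _) (norm_nonneg _)
      (by positivity)) (norm_nonneg _)
  have hHi : ∀ k, Integrable (H k) := by
    intro k
    refine ((integrable_kernel_mul hz g).norm.const_mul
      ((δ / α) ^ k.1 * (δ / α) ^ k.2)).mono' ?_ (Eventually.of_forall (hHb k))
    exact (((memLp_quadrantSymbol_theta hα 0 _).1.const_mul _).mul
      ((memLp_quadrantSymbol_theta hα 1 _).1.const_mul _)).mul
      (integrable_kernel_mul hz g).aestronglyMeasurable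
  have hgeo : Summable fun k : ℕ × ℕ => (δ / α) ^ k.1 * (δ / α) ^ k.2 :=
    (summable_geometric_of_lt_one hq0 hq1).mul_of_nonneg (summable_geometric_of_lt_one hq0 hq1)
      (fun n => pow_nonneg hq0 n) (fun n => pow_nonneg hq0 n)
  have hsum := hasSum_integral_of_summable_integral_norm hHi
    (Summable.of_nonneg_of_le (fun k => integral_nonneg fun ξ => norm_nonneg _)
      (fun k => (integral_mono (hHi k).norm ((integrable_kernel_mul hz g).norm.const_mul _)
        (hHb k)).trans_eq (integral_const_mul _ _)) (hgeo.mul_right _))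
  convert! hsum using 1
  · funext k
    rw [ext, ← integral_const_mul, ← integral_const_mul]
    refine integral_congr_ae ?_
    filter_upwards [fourier_fourierMultiplier (memLp_quadrantSymbol_theta hα 0 k.1)
      (fourierMultiplier (theta α 1 k.2) f),
      fourier_fourierMultiplier (memLp_quadrantSymbol_theta hα 1 k.2) f] with ξ h1 h2
    rw [h1, h2]
    simp only [H, a, b]
    ring
  · refine integral_congr_ae (Eventually.of_forall fun ξ => ?_)
    simp only [H]
    rw [tsum_mul_right]
    by_cases hξ : ξ ∈ quadrant
    · obtain ⟨s1, t1⟩ := hasSum_pow_mul_theta α 0 (τ 0) hξ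
      obtain ⟨s2, t2⟩ := hasSum_pow_mul_theta α 1 (τ 1) hξ
      have h3 := (tsum_mul_tsum_of_summable_norm s1 s2).symm
      rw [t1.tsum_eq, t2.tsum_eq] at h3
      rw [h3, ← mul_assoc, kernel_of_mem _ hξ, kernel_of_mem _ hξ, ← Complex.exp_add,
        ← Complex.exp_add]
      congr 2
      simp only [Fin.sum_univ_two, hw]
      ring
    · rw [kernel_of_notMem _ hξ, kernel_of_notMem _ hξ, zero_mul, mul_zero]

/-! ### Composition operators and dilations -/

theorem ext_add (f g : L2) {z : Fin 2 → ℂ} (hz : z ∈ upperHalf) :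
    ext (f + g) z = ext f z + ext g z := by
  obtain ⟨T, hT⟩ := exists_evalCLM hz
  simp_rw [← hT, map_add]

theorem ext_smul (c : ℂ) (f : L2) {z : Fin 2 → ℂ} (hz : z ∈ upperHalf) :
    ext (c • f) z = c * ext f z := by
  obtain ⟨T, hT⟩ := exists_evalCLM hz
  simp_rw [← hT, map_smul, smul_eq_mul]

/-- A self-map of `ℍ²` that preserves the Hardy class induces a bounded composition operator. -/
theorem exists_clm_comp {φ : (Fin 2 → ℂ) → (Fin 2 → ℂ)} (hφ : Set.MapsTo φ upperHalf upperHalf)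
    (h : ∀ f : L2, HardyClass (ext f ∘ φ)) :
    ∃ T : H2 →L[ℂ] H2, ∀ f : H2, Set.EqOn (ext (T f)) (ext f ∘ φ) upperHalf := by
  choose g hg hgφ using fun f : H2 => (h f).exists_spectral
  let T₀ : H2 → H2 := fun f => ⟨g f, H2_eq_spectral ▸ hg f⟩
  have hT₀ : ∀ f, Set.EqOn (ext (T₀ f)) (ext f ∘ φ) upperHalf := fun f => (hgφ f).symm
  have huniq : ∀ u v : H2, Set.EqOn (ext u) (ext v) upperHalf → u = v := fun u v huv =>
    Subtype.ext (ext_injOn (coe_mem_spectral u) (coe_mem_spectral v) huv)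
  let T : H2 →ₗ[ℂ] H2 :=
    { toFun := T₀
      map_add' := fun u v => huniq _ _ fun z hz =>
        calc ext (T₀ (u + v)) z = ext ((u : L2) + v) (φ z) := hT₀ (u + v) hz
          _ = ext u (φ z) + ext v (φ z) := ext_add _ _ (hφ hz)
          _ = ext (T₀ u) z + ext (T₀ v) z := by rw [hT₀ u hz, hT₀ v hz]; rfl
          _ = ext ((T₀ u : L2) + T₀ v) z := (ext_add _ _ hz).symm
      map_smul' := fun c u => huniq _ _ fun z hz =>
        calc ext (T₀ (c • u)) z = ext (c • (u : L2)) (φ z) := hT₀ (c • u) hz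
          _ = c * ext u (φ z) := ext_smul _ _ (hφ hz)
          _ = c * ext (T₀ u) z := by rw [hT₀ u hz]; rfl
          _ = ext (c • (T₀ u : L2)) z := (ext_smul _ _ hz).symm }
  have hT : Continuous T := by
    -- Closed graph theorem: evaluations at points of `ℍ²` are continuous and separate the elements
    -- of `H2`.
    refine LinearMap.continuous_of_seq_closed_graph T fun u x y hu hTu => huniq _ _ fun z hz => ?_
    obtain ⟨A, hA⟩ := exists_evalCLM hz
    obtain ⟨B, hB⟩ := exists_evalCLM (hφ hz)
    have h1 : Tendsto (fun n => A (T (u n))) atTop (𝓝 (A y)) :=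
      (A.continuous.tendsto _).comp ((continuous_subtype_val.tendsto _).comp hTu)
    have h2 : Tendsto (fun n => B (u n)) atTop (𝓝 (B x)) :=
      (B.continuous.tendsto _).comp ((continuous_subtype_val.tendsto _).comp hu)
    have h3 : ∀ v : H2, A (T v) = B v := fun v => by
      rw [hA, hB]
      exact hT₀ v hz
    simp_rw [h3] at h1
    have h4 := tendsto_nhds_unique h1 h2
    rw [← h3, hA, hA] at h4
    exact h4
  exact ⟨⟨T, hT⟩, hT₀⟩

/-- Any Hardy extension of `f` equals `ext f` on `ℍ²`, and `φ` maps `ℍ²` into itself, so it suffices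
to treat `ext f`. -/
theorem isCompositionOperator_of_ext {φ : (Fin 2 → ℂ) → (Fin 2 → ℂ)}
    (hφ : Set.MapsTo φ upperHalf upperHalf) {T : H2 →L[ℂ] H2}
    (hT : ∀ f : H2, Set.EqOn (ext (T f)) (ext f ∘ φ) upperHalf) : IsCompositionOperator φ T := by
  refine fun f => ⟨⟨_, isHardyExtension_ext (coe_mem_spectral f)⟩, fun F hF => ?_⟩
  refine (isHardyExtension_ext (coe_mem_spectral (T f))).congr fun z hz => ?_
  rw [hT f hz]
  exact (hF.mem_spectral.2 (hφ hz)).symm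

/-- The coordinatewise scaling of the plane. -/
def scale (q : Fin 2 → ℝ) (hq : ∀ j, q j ≠ 0) : Plane ≃ₗ[ℝ] Plane where
  toFun x := WithLp.toLp 2 fun k => q k * x k
  invFun x := WithLp.toLp 2 fun k => (q k)⁻¹ * x k
  map_add' x y := by
    ext k
    simp [mul_add]
  map_smul' c x := by
    ext k
    simp [mul_left_comm]
  left_inv x := by
    ext k
    simp [hq k]
  right_inv x := by
    ext k
    simp [hq k]

/-- The constant is left implicit: finiteness gives norm bounds, and proportionality lets null sets
be pulled back. -/
theorem map_scale (q : Fin 2 → ℝ) (hq : ∀ j, q j ≠ 0) :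
    ∃ c : ℝ≥0∞, c ≠ ∞ ∧ Measure.map (scale q hq) (volume : Measure Plane) = c • volume :=
  ⟨_, ENNReal.ofReal_ne_top, Measure.map_linearMap_addHaar_eq_smul_addHaar volume
    (f := (scale q hq).toLinearMap) (LinearEquiv.isUnit_det' _).ne_zero⟩

theorem continuous_scale (q : Fin 2 → ℝ) (hq : ∀ j, q j ≠ 0) : Continuous (scale q hq) :=
  (scale q hq).toLinearMap.continuous_of_finiteDimensional

theorem mapsTo_dilation {p : Fin 2 → ℝ} (hp : ∀ j, 0 < p j) :
    Set.MapsTo (dilation p) upperHalf upperHalf := fun z hz j => by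
  simpa [dilation] using mul_pos (hp j) (hz j)

theorem differentiable_dilation (p : Fin 2 → ℝ) : Differentiable ℂ (dilation p) := by
  unfold dilation
  fun_prop

theorem slice_comp_dilation (F : (Fin 2 → ℂ) → ℂ) {p : Fin 2 → ℝ} (hp : ∀ j, p j ≠ 0)
    (y : Fin 2 → ℝ) : slice (F ∘ dilation p) y = slice F (fun j => p j * y j) ∘ scale p hp := by
  funext x
  simp only [slice, Function.comp]
  congr 1
  funext j
  simp [dilation, point, scale]
  ring

theorem HardyClass.comp_dilation {F : (Fin 2 → ℂ) → ℂ} (hF : HardyClass F) {p : Fin 2 → ℝ}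
    (hp : ∀ j, 0 < p j) : HardyClass (F ∘ dilation p) := by
  obtain ⟨hd, M, hM⟩ := hF
  have hp' : ∀ j, p j ≠ 0 := fun j => (hp j).ne'
  obtain ⟨c, hc, hmap⟩ := map_scale p hp'
  refine ⟨hd.comp (differentiable_dilation p).differentiableOn (mapsTo_dilation hp),
    (c ^ (1 / (2 : ℝ≥0∞)).toReal).toNNReal * M, fun y hy => ?_⟩
  have hpy : ∀ j, 0 < p j * y j := fun j => mul_pos (hp j) (hy j)
  rw [slice_comp_dilation F hp', ← eLpNorm_map_measure
    (continuous_slice hd hpy).aestronglyMeasurable (continuous_scale p hp').aemeasurable, hmap,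
    eLpNorm_smul_measure_of_ne_top (by norm_num), smul_eq_mul, ENNReal.coe_mul,
    ENNReal.coe_toNNReal (ENNReal.rpow_ne_top_of_nonneg (by positivity) hc)]
  exact mul_le_mul_right (hM _ hpy) _

theorem SlicesTendsto.comp_dilation {F : (Fin 2 → ℂ) → ℂ} {b : Plane → ℂ} (hF : SlicesTendsto F b)
    {p : Fin 2 → ℝ} (hp : ∀ j, 0 < p j) :
    SlicesTendsto (F ∘ dilation p) (b ∘ scale p fun j => (hp j).ne') := by
  intro R y hy0 hy
  have hp' : ∀ j, p j ≠ 0 := fun j => (hp j).ne'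
  obtain ⟨c, hc, hmap⟩ := map_scale p hp'
  set A : Plane →L[ℝ] Plane := LinearMap.toContinuousLinearMap (scale p hp').toLinearMap with hA
  -- The radius is enlarged so that scaling sends the ball of radius `R` into the ball where
  -- convergence is known.
  obtain ⟨ns, hns, hlim⟩ := hF (‖A‖ * R) (fun n j => p j * y n j)
    (fun n j => mul_pos (hp j) (hy0 n j)) (tendsto_pi_nhds.2 fun j => by
      simpa using ((tendsto_pi_nhds.1 hy) j).const_mul (p j))
  refine ⟨ns, hns, ?_⟩
  rw [ae_restrict_iff' measurableSet_closedBall] at hlim ⊢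
  have hq : Measure.QuasiMeasurePreserving (scale p hp') volume volume :=
    ⟨(continuous_scale p hp').measurable, by rw [hmap]; exact Measure.smul_absolutelyContinuous⟩
  filter_upwards [hq.ae hlim] with x hx hxR
  have h1 : scale p hp' x ∈ Metric.closedBall (0 : Plane) (‖A‖ * R) := by
    rw [mem_closedBall_zero_iff] at hxR ⊢
    exact (A.le_opNorm x).trans (mul_le_mul_of_nonneg_left hxR (norm_nonneg _))
  refine (hx h1).congr fun i => ?_
  rw [slice_comp_dilation F hp']
  rfl

/-! ### The symbols `τ_j` and the operator series -/

/-- Expand `|iα - w|² = α² - 2α Im w + |w|²`. The lower bound on `Im w` is what can bring this below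
`α²`. -/
theorem norm_I_mul_sub_le {ε M α : ℝ} {w : ℂ} (hα : 0 ≤ α) (hw : ‖w‖ ≤ M) (hε : ε < w.im) :
    ‖Complex.I * α - w‖ ≤ √(α ^ 2 + M ^ 2 - 2 * α * ε) := by
  refine Real.le_sqrt_of_sq_le ?_
  have h1 : ‖w‖ ^ 2 ≤ M ^ 2 := pow_le_pow_left₀ (norm_nonneg _) hw 2
  rw [← Complex.normSq_eq_norm_sq, Complex.normSq_apply] at h1 ⊢
  simp only [Complex.sub_re, Complex.sub_im, Complex.mul_re, Complex.mul_im, Complex.I_re,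
    Complex.I_im, Complex.ofReal_re, Complex.ofReal_im]
  nlinarith

theorem slicesTendsto_tau {ψ : (Fin 2 → ℂ) → ℂ} {b : Plane → ℂ} (h : SlicesTendsto ψ b)
    {p : Fin 2 → ℝ} (hp : ∀ j, 0 < p j) (α : ℝ) (n : ℕ) :
    SlicesTendsto (fun z => (Complex.I * α - ψ (dilation p⁻¹ z)) ^ n)
      (fun x => tau α p b x ^ n) := by
  intro R y hy0 hy
  obtain ⟨ns, hns, hlim⟩ :=
    h.comp_dilation (p := p⁻¹) (fun j => inv_pos.2 (hp j)) R y hy0 hy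
  refine ⟨ns, hns, ?_⟩
  filter_upwards [hlim] with x hx
  have h2 := (hx.const_sub (Complex.I * α)).pow n
  convert! h2 using 2
  simp [tau, scale, div_eq_inv_mul]

theorem quasiMeasurePreserving_scale (q : Fin 2 → ℝ) (hq : ∀ j, q j ≠ 0) :
    Measure.QuasiMeasurePreserving (scale q hq) volume volume := by
  obtain ⟨c, _, hmap⟩ := map_scale q hq
  exact ⟨(continuous_scale q hq).measurable, by rw [hmap]; exact Measure.smul_absolutelyContinuous⟩

section Symbol

variable {p : Fin 2 → ℝ} {ψ : (Fin 2 → ℂ) → ℂ} {b : Plane → ℂ} {ε M α : ℝ}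

theorem norm_symbol_pow_le (hp : ∀ j, 0 < p j) (hM : ∀ z ∈ upperHalf, ‖ψ z‖ ≤ M)
    (him : ∀ z ∈ upperHalf, ε < (ψ z).im) (hα : 0 ≤ α) (n : ℕ) :
    ∀ z ∈ upperHalf, ‖(Complex.I * α - ψ (dilation p⁻¹ z)) ^ n‖ ≤
      √(α ^ 2 + M ^ 2 - 2 * α * ε) ^ n := fun z hz => by
  have hz' := mapsTo_dilation (p := p⁻¹) (fun j => inv_pos.2 (hp j)) hz
  rw [norm_pow]
  exact pow_le_pow_left₀ (norm_nonneg _) (norm_I_mul_sub_le hα (hM _ hz') (him _ hz')) n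

theorem norm_tau_pow_le (hp : ∀ j, 0 < p j) (hM : ∀ z ∈ upperHalf, ‖ψ z‖ ≤ M)
    (him : ∀ z ∈ upperHalf, ε < (ψ z).im) (hb : SlicesTendsto ψ b) (hα : 0 ≤ α) (n : ℕ) :
    ∀ᵐ x, ‖tau α p b x ^ n‖ ≤ √(α ^ 2 + M ^ 2 - 2 * α * ε) ^ n :=
  (slicesTendsto_tau hb hp α n).norm_le (norm_symbol_pow_le hp hM him hα n)

theorem aestronglyMeasurable_tau_pow (hp : ∀ j, 0 < p j) (hb : AEStronglyMeasurable b volume)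
    (n : ℕ) : AEStronglyMeasurable (fun x => tau α p b x ^ n) volume := by
  have h1 := hb.comp_quasiMeasurePreserving
    (quasiMeasurePreserving_scale p⁻¹ fun j => (inv_pos.2 (hp j)).ne')
  refine (((aestronglyMeasurable_const (b := Complex.I * α)).sub h1).pow n).congr (Eventually.of_forall fun x => ?_)
  simp [tau, scale, div_eq_inv_mul]

theorem ext_toeplitz_tau_pow (hp : ∀ j, 0 < p j) (hψ : DifferentiableOn ℂ ψ upperHalf)
    (hM : ∀ z ∈ upperHalf, ‖ψ z‖ ≤ M) (him : ∀ z ∈ upperHalf, ε < (ψ z).im)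
    (hbm : AEStronglyMeasurable b volume) (hb : SlicesTendsto ψ b) (hα : 0 ≤ α) (n : ℕ) (f : H2) :
    Set.EqOn (ext (toeplitz (fun x => tau α p b x ^ n) f))
      (fun z => (Complex.I * α - ψ (dilation p⁻¹ z)) ^ n * ext f z) upperHalf := by
  refine ext_toeplitz (memLp_top_of_bound (aestronglyMeasurable_tau_pow hp hbm n) _
    (norm_tau_pow_le hp hM him hb hα n)) ?_ (norm_symbol_pow_le hp hM him hα n)
    (slicesTendsto_tau hb hp α n) f
  have h1 := hψ.comp (differentiable_dilation p⁻¹).differentiableOn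
    (mapsTo_dilation (p := p⁻¹) fun j => inv_pos.2 (hp j))
  exact (h1.const_sub (Complex.I * α)).fun_pow n

end Symbol

theorem opNorm_comp_le_of_le {E : Type*} [NormedAddCommGroup E] [NormedSpace ℂ E]
    {S T : E →L[ℂ] E} {a b : ℝ} (hS : ‖S‖ ≤ a) (hT : ‖T‖ ≤ b) : ‖S ∘L T‖ ≤ a * b :=
  (ContinuousLinearMap.opNorm_comp_le S T).trans
    (mul_le_mul hS hT (norm_nonneg T) ((norm_nonneg S).trans hS))

theorem summable_of_opNorm_le {E : Type*} [NormedAddCommGroup E] [NormedSpace ℂ E]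
    [CompleteSpace E] {A : ℕ × ℕ → E →L[ℂ] E} {q : ℝ} (hq0 : 0 ≤ q) (hq1 : q < 1)
    (h : ∀ k, ‖A k‖ ≤ q ^ k.1 * q ^ k.2) : Summable A := by
  have hg := summable_geometric_of_lt_one hq0 hq1
  exact Summable.of_norm_bounded (hg.mul_of_nonneg hg (fun n => pow_nonneg hq0 n)
    fun n => pow_nonneg hq0 n) h

theorem ext_tsum {ι : Type*} {A : ι → H2 →L[ℂ] H2} {S : H2 →L[ℂ] H2} (hA : HasSum A S) (f : H2)
    {z : Fin 2 → ℂ} (hz : z ∈ upperHalf) : HasSum (fun k => ext (A k f) z) (ext (S f) z) := by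
  obtain ⟨T, hT⟩ := exists_evalCLM hz
  have h1 : HasSum (fun k => A k f) (S f) := (ContinuousLinearMap.apply ℂ H2 f).hasSum hA
  have h2 : HasSum (fun k => T (A k f : L2)) (T (S f : L2)) := (T ∘L H2.subtypeL).hasSum h1
  simpa only [hT] using h2

/-- The terms of the expansion of the composition operator. -/
def seriesTerm (α : ℝ) (p : Fin 2 → ℝ) (b : Fin 2 → Plane → ℂ) (k : ℕ × ℕ) : H2 →L[ℂ] H2 :=
  toeplitz (fun x => tau α p (b 0) x ^ k.1) ∘L
    toeplitz (fun x => tau α p (b 1) x ^ k.2) ∘L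
      fourierMultiplier (theta α 0 k.1) ∘L
        fourierMultiplier (theta α 1 k.2)

section Series

variable {p : Fin 2 → ℝ} {ψ : Fin 2 → (Fin 2 → ℂ) → ℂ} {b : Fin 2 → Plane → ℂ} {ε M α : ℝ}

theorem norm_seriesTerm_le (hp : ∀ j, 0 < p j) (hM : ∀ j, ∀ z ∈ upperHalf, ‖ψ j z‖ ≤ M)
    (him : ∀ j, ∀ z ∈ upperHalf, ε < (ψ j z).im) (hb : ∀ j, SlicesTendsto (ψ j) (b j))
    (hα : 0 < α) (k : ℕ × ℕ) :
    ‖seriesTerm α p b k‖ ≤ (√(α ^ 2 + M ^ 2 - 2 * α * ε) / α) ^ k.1 *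
      (√(α ^ 2 + M ^ 2 - 2 * α * ε) / α) ^ k.2 := by
  set δ := √(α ^ 2 + M ^ 2 - 2 * α * ε) with hδ
  have hδ0 : 0 ≤ δ := Real.sqrt_nonneg _
  have h1 := norm_toeplitz_le (pow_nonneg hδ0 k.1)
    (norm_tau_pow_le hp (hM 0) (him 0) (hb 0) hα.le k.1)
  have h2 := norm_toeplitz_le (pow_nonneg hδ0 k.2)
    (norm_tau_pow_le hp (hM 1) (him 1) (hb 1) hα.le k.2)
  have h3 := norm_fourierMultiplier_le (inv_nonneg.2 (pow_nonneg hα.le k.1))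
    (norm_quadrantSymbol_theta_le hα 0 k.1)
  have h4 := norm_fourierMultiplier_le (inv_nonneg.2 (pow_nonneg hα.le k.2))
    (norm_quadrantSymbol_theta_le hα 1 k.2)
  refine (opNorm_comp_le_of_le h1
    (opNorm_comp_le_of_le h2 (opNorm_comp_le_of_le h3 h4))).trans_eq ?_
  rw [div_pow, div_pow]
  field_simp

theorem summable_seriesTerm (hp : ∀ j, 0 < p j) (hM : ∀ j, ∀ z ∈ upperHalf, ‖ψ j z‖ ≤ M)
    (him : ∀ j, ∀ z ∈ upperHalf, ε < (ψ j z).im) (hb : ∀ j, SlicesTendsto (ψ j) (b j))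
    (hα : 0 < α) (hδ : √(α ^ 2 + M ^ 2 - 2 * α * ε) < α) : Summable (seriesTerm α p b) := by
  exact summable_of_opNorm_le (by positivity) ((div_lt_one hα).2 hδ)
    (norm_seriesTerm_le hp hM him hb hα)

/-- Evaluation at `w` is continuous, so the operator series may be summed at `w`. There each
Toeplitz factor becomes a power of the number `iα - ψ_j(w/p)`, and the expansion at a fixed point
applies. -/
theorem ext_of_hasSum_seriesTerm (hp : ∀ j, 0 < p j)
    (hψ : ∀ j, DifferentiableOn ℂ (ψ j) upperHalf)
    (hM : ∀ j, ∀ z ∈ upperHalf, ‖ψ j z‖ ≤ M) (him : ∀ j, ∀ z ∈ upperHalf, ε < (ψ j z).im)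
    (hbm : ∀ j, AEStronglyMeasurable (b j) volume) (hb : ∀ j, SlicesTendsto (ψ j) (b j))
    (hα : 0 < α) (hδ : √(α ^ 2 + M ^ 2 - 2 * α * ε) < α) {S : H2 →L[ℂ] H2}
    (hS : HasSum (seriesTerm α p b) S) (f : H2) {w : Fin 2 → ℂ} (hw : w ∈ upperHalf) :
    ext (S f) w = ext f fun j => w j + ψ j (dilation p⁻¹ w) := by
  refine (ext_tsum hS f hw).unique ?_
  have h1 := hasSum_ext hα (Real.sqrt_nonneg _) hδ f hw
    (τ := fun j => Complex.I * α - ψ j (dilation p⁻¹ w))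
    (w := fun j => w j + ψ j (dilation p⁻¹ w))
    (fun j => by simpa using norm_symbol_pow_le hp (hM j) (him j) hα.le 1 w hw)
    (fun j => by ring)
  refine h1.congr_fun fun k => ?_
  have e1 := ext_toeplitz_tau_pow hp (hψ 0) (hM 0) (him 0) (hbm 0) (hb 0) hα.le k.1
    (toeplitz (fun x => tau α p (b 1) x ^ k.2)
      (fourierMultiplier (theta α 0 k.1) (fourierMultiplier (theta α 1 k.2) f))) hw
  have e2 := ext_toeplitz_tau_pow hp (hψ 1) (hM 1) (him 1) (hbm 1) (hb 1) hα.le k.2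
    (fourierMultiplier (theta α 0 k.1) (fourierMultiplier (theta α 1 k.2) f)) hw
  refine Eq.trans e1 ?_
  simp only [e2]

end Series

end BiHardy

end

/-! ### The theorem -/

open BiHardy in
theorem proposition8 (p : Fin 2 → ℝ) (hp : ∀ j, 0 < p j)
    (ψ : Fin 2 → (Fin 2 → ℂ) → ℂ)
    (hψ_hol : ∀ j, DifferentiableOn ℂ (ψ j) upperHalf)
    (hψ_bdd : ∀ j, ∃ M : ℝ, ∀ z ∈ upperHalf, ‖ψ j z‖ ≤ M)
    (ε : ℝ) (hε : 0 < ε) (hψ_im : ∀ j, ∀ z ∈ upperHalf, ε < (ψ j z).im) :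
    -- the boundary functions of `ψ₁, ψ₂`, the composition operator and the dilation operator
    ∃ (b : Fin 2 → Plane → ℂ) (C V : H2 →L[ℂ] H2),
      (∀ j, IsBoundaryFunction (ψ j) (b j) ∧ MemLp (b j) ∞ volume) ∧
      IsCompositionOperator (fun z j => (p j : ℂ) * z j + ψ j z) C ∧
      IsCompositionOperator (dilation p) V ∧
      ∃ α : ℝ, 0 < α ∧
        -- the Fourier multipliers map the Hardy space into itself
        (∀ j n, ∀ f ∈ H2, fourierMultiplierL2 (theta α j n) f ∈ H2) ∧
        ∃ S : H2 →L[ℂ] H2,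
          HasSum (fun k : ℕ × ℕ =>
            toeplitz (fun x => tau α p (b 0) x ^ k.1) ∘L
              toeplitz (fun x => tau α p (b 1) x ^ k.2) ∘L
                fourierMultiplier (theta α 0 k.1) ∘L
                  fourierMultiplier (theta α 1 k.2)) S ∧
          C = V ∘L S := by
  choose Mj hMj using hψ_bdd
  set M : ℝ := max (Mj 0) (Mj 1) with hM
  have hψM : ∀ j, ∀ z ∈ upperHalf, ‖ψ j z‖ ≤ M := fun j z hz => (hMj j z hz).trans (by
    fin_cases j
    · exact le_max_left _ _
    · exact le_max_right _ _)
  choose b hb using fun j => exists_isBoundaryFunction (hψ_hol j) (hψM j)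
  have hbs : ∀ j, SlicesTendsto (ψ j) (b j) := fun j => (hb j).slicesTendsto (hψ_hol j)
  obtain ⟨V, hV⟩ := exists_clm_comp (mapsTo_dilation hp)
    fun f => (hardyClass_ext f).comp_dilation hp
  -- Now `αε = M² + ε`, so `α² + M² - 2αε = α² - M² - 2ε < α²`; the summand `1` makes `α` positive
  -- without examining `M`.
  set α : ℝ := M ^ 2 / ε + 1 with hαdef
  have hα : 0 < α := by positivity
  have hδ : √(α ^ 2 + M ^ 2 - 2 * α * ε) < α := by
    rw [Real.sqrt_lt' hα]
    have : α * ε = M ^ 2 + ε := by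
      rw [hαdef]
      field_simp
    nlinarith [sq_nonneg M]
  have hsum := summable_seriesTerm hp hψM hψ_im hbs hα hδ
  have hφ : Set.MapsTo (fun (z : Fin 2 → ℂ) j => (p j : ℂ) * z j + ψ j z) upperHalf upperHalf := by
    intro z hz j
    have h1 := mul_pos (hp j) (hz j)
    have h2 := hψ_im j z hz
    simp
    linarith
  refine ⟨b, V ∘L ∑' k, seriesTerm α p b k, V, fun j => ⟨hb j, memLp_top_of_bound (hb j).1 M
    -- The composition operator is taken to be `V ∘L S`; that it acts as `f ↦ f ∘ φ` is verified on
    -- `ext f`.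
    ((hbs j).norm_le (hψM j))⟩, isCompositionOperator_of_ext hφ fun f z hz => ?_,
    isCompositionOperator_of_ext (mapsTo_dilation hp) hV, α, hα, fun j n f _ => ?_,
    ∑' k, seriesTerm α p b k, hsum.hasSum, rfl⟩
  -- At `w = (p₁z₁, p₂z₂)` the shifted point `w + ψ(w/p)` is `φ(z)`.
  · have h1 : dilation p⁻¹ (dilation p z) = z := by
      funext j
      simp [dilation, (hp j).ne']
    refine (hV _ hz).trans ((ext_of_hasSum_seriesTerm hp hψ_hol hψM hψ_im
      (fun j => (hb j).1) hbs hα hδ hsum.hasSum f (mapsTo_dilation hp hz)).trans ?_)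
    rw [h1]
    rfl
  · rw [H2_eq_spectral]
    exact fourierMultiplierL2_mem (memLp_quadrantSymbol_theta hα j n) f
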